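/- Let $R$ be a non-constant rational function over $\mathbb{C}$ of degree $d\le 2$ (the degree of $R=P/Q$ in lowest terms is $\max(\deg P,\deg Q)$), let $\lambda\in\mathbb{C}$, $\lambda\neq 0$, and put $\partial_z R(w):=\lambda\, w\, R'(w)$. Two rational functions $R,S$ share the value $a$ in $\mathbb{C}^*=\mathbb{C}\setminus\{0\}$ (ignoring multiplicities) if for all $w\in\mathbb{C}^*$ one has $R(w)=a$ if and only if $S(w)=a$. For $C\in\mathbb{C}$, $C\ne0$, let $$R_{(1)}(w)=\left(\frac{A+BCw}{1+Cw}\right)^2,\quad A=\frac{1-\sqrt5}{2},\ B=\frac{1+\sqrt5}{2},\qquad\qquad R_{(2)}(w)=\frac{2}{1-Cw}.$$ Suppose that $R$ and $\partial_z R$ share two distinct finite values $a,b\in\mathbb{C}$ in $\mathbb{C}^*$. Then either $R\equiv\partial_z R$, or one of the two values is $0$, and, denoting the other one by $\beta\neq0$, there is some $C\neq0$ such that one of the following holds: (1) $R(w)=\beta\,R_{(1)}(w^{n})$ with $n\in\{1,-1\}$ and $\lambda n=\sqrt5/2$; (2) $R(w)=\beta\,R_{(2)}(w^{n})$ with $n\in\{d,-d\}$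 and $\lambda n=-2$. In particular, if $a$ and $b$ are both nonzero, then $R\equiv\partial_z R$. -/

import Mathlib

noncomputable section

namespace SharedValues

/-- The degree of a rational function `P / Q` in lowest terms: the larger of the degrees of `P`
and `Q`. For a non-constant function this is the number of preimages of every point of the
sphere, counted with multiplicity. -/
def degree (R : RatFunc ℂ) : ℕ :=
  max R.num.natDegree R.denom.natDegree

open Classical in
/-- The value of a rational function at a finite point, as a point of the Riemann sphere
(`∞` at a pole). `R.num` and `R.denom` are coprime. -/
def value (R : RatFunc ℂ) (w : ℂ) : OnePoint ℂ :=
  if R.denom.eval w = 0 then OnePoint.infty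
  else ((R.num.eval w / R.denom.eval w : ℂ) : OnePoint ℂ)

/-- `R` and `S` share the value `a` in the set `G`, ignoring multiplicities: the equations
`R(w) = a` and `S(w) = a` have the same solutions `w ∈ G`. -/
def Share (R S : RatFunc ℂ) (a : OnePoint ℂ) (G : Set ℂ) : Prop :=
  ∀ w ∈ G, (value R w = a ↔ value S w = a)

/-- The derivative of a rational function, by the quotient rule. -/
def derivative (R : RatFunc ℂ) : RatFunc ℂ :=
  algebraMap (Polynomial ℂ) (RatFunc ℂ)
      (Polynomial.derivative R.num * R.denom - R.num * Polynomial.derivative R.denom) /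
    algebraMap (Polynomial ℂ) (RatFunc ℂ) (R.denom ^ 2)

/-- `∂_z R(w) = lam * w * R'(w)`: the derivative of `z ↦ R(exp (lam * z))`, expressed in the
variable `w = exp (lam * z)`. -/
def dz (lam : ℂ) (R : RatFunc ℂ) : RatFunc ℂ :=
  RatFunc.C lam * RatFunc.X * derivative R

/-- The rational function `w ↦ S(w ^ n)`, for an integer `n ≠ 0`: the power `X ^ n` is
substituted for the variable of `S`. -/
def substPow (S : RatFunc ℂ) (n : ℤ) : RatFunc ℂ :=
  RatFunc.eval RatFunc.C ((RatFunc.X : RatFunc ℂ) ^ n) S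

/-- The pair `(R, lam)` arises from the pair `(S, mu)` by multiplying `S` by `β ≠ 0` and
substituting `w ^ n` for `w`, where `n ≠ 0`; the parameter changes so that `lam * n = mu`. -/
def IsTransform (R : RatFunc ℂ) (lam : ℂ) (S : RatFunc ℂ) (mu β : ℂ) (n : ℤ) : Prop :=
  β ≠ 0 ∧ n ≠ 0 ∧ lam * (n : ℂ) = mu ∧ R = RatFunc.C β * substPow S n

/-- The function `((A + B * c * w) / (1 + c * w)) ^ 2` with `A = (1 - √5) / 2` and
`B = (1 + √5) / 2`. -/
def gundersenOne (c : ℂ) : RatFunc ℂ :=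
  ((RatFunc.C ((1 - (Real.sqrt 5 : ℂ)) / 2) +
      RatFunc.C ((1 + (Real.sqrt 5 : ℂ)) / 2) * RatFunc.C c * RatFunc.X) /
    (1 + RatFunc.C c * RatFunc.X)) ^ 2

/-- The function `2 / (1 - c * w)`. -/
def gundersenTwo (c : ℂ) : RatFunc ℂ :=
  2 / (1 - RatFunc.C c * RatFunc.X)

end SharedValues

end

/-!
Replacing `w` by `w ^ 2` (and `λ` by `λ / 2`) in degree one, the function `R = P / Q` may be taken
of degree two, and everything becomes a statement about the six coefficients of `P` and `Q`
(`QuadPair`). Let `W = P' Q - P Q'`, so that `λ w R' = λ w W / Q ^ 2`. A shared value `a` says that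
`P - a Q` and `λ w W - a Q ^ 2` have the same zeros in `ℂ \ {0}` off the poles of `R`.

If `a ≠ 0` is shared, then all `a`-points in `ℂ \ {0}` are simple, and `R` takes the value `a`
neither at `0` nor at `∞` (`Shares.value_zero_ne`): otherwise at most one `a`-point is left in
`ℂ \ {0}`, all zeros of `λ w W - a Q ^ 2` have to be there, up to one simple zero at a double pole,
and comparing coefficients excludes this, as `P` and `Q` have no common zero. Hence `R` has exactly
two `a`-points on the sphere, both in `ℂ \ {0}` (`Shares.exists_points`).

If `a` and `b` are both nonzero, then `P Q - λ w W`, of degree at most four, vanishes at the four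
points where `R` is `a` or `b`. Hence it is `k (P - a Q) (P - b Q)`, that is, `R` satisfies the
Riccati equation `λ w R' = R - k (R - a) (R - b)`. If `k ≠ 0`, then `λ w R'` takes the value `a`
wherever `R = b + 1 / k`; such points exist in `ℂ \ {0}`, because `λ w R'` vanishes at `0` and `∞`
when `R` is finite there. Hence `b + 1 / k = a`. By symmetry `a + 1 / k = b`, which is absurd. So
`k = 0` and `R = λ w R'` (`fixed_of_shares`).

If `a = 0`, every critical point of `R` in `ℂ \ {0}` is a double zero or a double pole. As `R` has
two critical points on the sphere, few configurations are left (`classification`). Critical points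
`0` and `∞` mean that `R` is a function of `w ^ 2` without zeros in `ℂ \ {0}` (`even`). Exactly one
of `0` and `∞` being critical is impossible (`not_critical_infinity`). A double zero and a double
pole in `ℂ \ {0}` lead to the equation `(t - 1) ^ 2 * (t + 1) = 1`, that is `t ^ 2 = t + 1`, which
brings in `√5` (`exceptionalOne_of_double`).
-/

namespace SharedValues

/-! ### Factoring polynomials of degree at most four -/

theorem exists_factor_quadratic {c2 : ℂ} (h : c2 ≠ 0) (c0 c1 : ℂ) :
    ∃ x y, c1 = -c2 * (x + y) ∧ c0 = c2 * (x * y) := by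
  obtain ⟨s, hs⟩ := IsAlgClosed.exists_pow_nat_eq (c1 ^ 2 - 4 * c2 * c0) (n := 2) (by norm_num)
  refine ⟨(-c1 + s) / (2 * c2), (-c1 - s) / (2 * c2), ?_, ?_⟩
  · field_simp; ring
  · field_simp; linear_combination hs

theorem exists_factor_cubic {c3 : ℂ} (h : c3 ≠ 0) (c0 c1 c2 : ℂ) :
    ∃ x y z, c2 = -c3 * (x + y + z) ∧ c1 = c3 * (x * y + x * z + y * z) ∧
      c0 = -c3 * (x * y * z) := by
  obtain ⟨x, hx⟩ := IsAlgClosed.exists_root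
    (Polynomial.C c3 * Polynomial.X ^ 3 + Polynomial.C c2 * Polynomial.X ^ 2 +
      Polynomial.C c1 * Polynomial.X + Polynomial.C c0)
    (by rw [Polynomial.degree_cubic h]; norm_num)
  simp only [Polynomial.IsRoot, Polynomial.eval_add, Polynomial.eval_mul, Polynomial.eval_C,
    Polynomial.eval_pow, Polynomial.eval_X] at hx
  obtain ⟨y, z, h1, h0⟩ := exists_factor_quadratic h (c1 + (c2 + c3 * x) * x) (c2 + c3 * x)
  refine ⟨x, y, z, ?_, ?_, ?_⟩
  · linear_combination h1
  · linear_combination h0 - x * h1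
  · linear_combination hx - x * h0

theorem exists_factor_quartic {c4 : ℂ} (h : c4 ≠ 0) (c0 c1 c2 c3 : ℂ) :
    ∃ x y z t, c3 = -c4 * (x + y + z + t) ∧
      c2 = c4 * (x * y + x * z + x * t + y * z + y * t + z * t) ∧
      c1 = -c4 * (x * y * z + x * y * t + x * z * t + y * z * t) ∧
      c0 = c4 * (x * y * z * t) := by
  obtain ⟨x, hx⟩ := IsAlgClosed.exists_root
    (Polynomial.C c4 * Polynomial.X ^ 4 + Polynomial.C c3 * Polynomial.X ^ 3 +
      Polynomial.C c2 * Polynomial.X ^ 2 + Polynomial.C c1 * Polynomial.X + Polynomial.C c0)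
    (by
      have : (Polynomial.C c4 * Polynomial.X ^ 4 + Polynomial.C c3 * Polynomial.X ^ 3 +
        Polynomial.C c2 * Polynomial.X ^ 2 + Polynomial.C c1 * Polynomial.X +
          Polynomial.C c0).degree = 4 := by compute_degree!
      rw [this]; norm_num)
  simp only [Polynomial.IsRoot, Polynomial.eval_add, Polynomial.eval_mul, Polynomial.eval_C,
    Polynomial.eval_pow, Polynomial.eval_X] at hx
  obtain ⟨y, z, t, h2, h1, h0⟩ := exists_factor_cubic h
    (c1 + (c2 + (c3 + c4 * x) * x) * x) (c2 + (c3 + c4 * x) * x) (c3 + c4 * x)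
  refine ⟨x, y, z, t, ?_, ?_, ?_, ?_⟩
  · linear_combination h2
  · linear_combination h1 - x * h2
  · linear_combination h0 - x * h1
  · linear_combination hx - x * h0

/-- The divided difference of a quartic polynomial at two of its zeros. -/
theorem quartic_dividedDifference {c0 c1 c2 c3 c4 x y : ℂ} (hxy : x ≠ y)
    (hx : c0 + c1 * x + c2 * x ^ 2 + c3 * x ^ 3 + c4 * x ^ 4 = 0)
    (hy : c0 + c1 * y + c2 * y ^ 2 + c3 * y ^ 3 + c4 * y ^ 4 = 0) :
    c1 + c2 * (x + y) + c3 * (x ^ 2 + x * y + y ^ 2) +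
      c4 * (x ^ 3 + x ^ 2 * y + x * y ^ 2 + y ^ 3) = 0 := by
  apply mul_left_cancel₀ (sub_ne_zero.2 hxy)
  linear_combination hx - hy

theorem quartic_eq_of_two_roots {c0 c1 c2 c3 c4 x y : ℂ} (hxy : x ≠ y)
    (hx : c0 + c1 * x + c2 * x ^ 2 + c3 * x ^ 3 + c4 * x ^ 4 = 0)
    (hy : c0 + c1 * y + c2 * y ^ 2 + c3 * y ^ 3 + c4 * y ^ 4 = 0) (w : ℂ) :
    c0 + c1 * w + c2 * w ^ 2 + c3 * w ^ 3 + c4 * w ^ 4 = (w - x) * (w - y) *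
      ((c2 + c3 * (x + y) + c4 * (x ^ 2 + x * y + y ^ 2)) + (c3 + c4 * (x + y)) * w +
        c4 * w ^ 2) := by
  linear_combination hx + (w - x) * quartic_dividedDifference hxy hx hy

theorem quartic_eq_of_four_roots {c0 c1 c2 c3 c4 x y z t : ℂ} (hxy : x ≠ y) (hxz : x ≠ z)
    (hxt : x ≠ t) (hyz : y ≠ z) (hyt : y ≠ t) (hzt : z ≠ t)
    (hx : c0 + c1 * x + c2 * x ^ 2 + c3 * x ^ 3 + c4 * x ^ 4 = 0)
    (hy : c0 + c1 * y + c2 * y ^ 2 + c3 * y ^ 3 + c4 * y ^ 4 = 0)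
    (hz : c0 + c1 * z + c2 * z ^ 2 + c3 * z ^ 3 + c4 * z ^ 4 = 0)
    (ht : c0 + c1 * t + c2 * t ^ 2 + c3 * t ^ 3 + c4 * t ^ 4 = 0) (w : ℂ) :
    c0 + c1 * w + c2 * w ^ 2 + c3 * w ^ 3 + c4 * w ^ 4 =
      c4 * ((w - x) * (w - y) * (w - z) * (w - t)) := by
  have h := quartic_eq_of_two_roots hxy hx hy
  have hz' := h z
  have ht' := h t
  rw [hz, eq_comm, mul_eq_zero] at hz'
  rw [ht, eq_comm, mul_eq_zero] at ht'
  replace hz' := hz'.resolve_left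
    (mul_ne_zero (sub_ne_zero.2 hxz.symm) (sub_ne_zero.2 hyz.symm))
  replace ht' := ht'.resolve_left
    (mul_ne_zero (sub_ne_zero.2 hxt.symm) (sub_ne_zero.2 hyt.symm))
  have h3 : c3 + c4 * (x + y) + c4 * (z + t) = 0 := by
    apply mul_left_cancel₀ (sub_ne_zero.2 hzt)
    linear_combination hz' - ht'
  rw [h w]
  linear_combination (w - x) * (w - y) * (hz' + (w - z) * h3)

theorem ofReal_sqrt_five_sq : (Real.sqrt 5 : ℂ) ^ 2 = 5 := by
  rw [← Complex.ofReal_pow, Real.sq_sqrt (by norm_num)]; norm_num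

/-! ### Functions of degree two by their coefficients -/

/-- The coefficients of two polynomials of degree at most two, the numerator `P` and the denominator
`Q` of a rational function `R`. -/
structure QuadPair where
  p0 : ℂ
  p1 : ℂ
  p2 : ℂ
  q0 : ℂ
  q1 : ℂ
  q2 : ℂ

namespace QuadPair

variable (f : QuadPair)

/-- The numerator. -/
def P (w : ℂ) : ℂ := f.p0 + f.p1 * w + f.p2 * w ^ 2

/-- The denominator. -/
def Q (w : ℂ) : ℂ := f.q0 + f.q1 * w + f.q2 * w ^ 2

/-- `P' Q - P Q'`, the numerator of the derivative. -/
def W (w : ℂ) : ℂ :=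
  (f.p1 * f.q0 - f.p0 * f.q1) + 2 * (f.p2 * f.q0 - f.p0 * f.q2) * w +
    (f.p2 * f.q1 - f.p1 * f.q2) * w ^ 2

/-- `P` and `Q` have no common zero, in `ℂ` or at `∞`. This makes `P / Q` a function of degree
exactly two; in particular it is not constant. -/
structure Coprime : Prop where
  finite : ∀ w, f.P w = 0 → f.Q w ≠ 0
  infinity : f.p2 = 0 → f.q2 ≠ 0

/-- `R` and `λ w R'` share the finite value `a` in `ℂ \ {0}`, off the poles of `R`. (At a pole of
`R` in `ℂ \ {0}` both functions are infinite.) -/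
def Shares (lam a : ℂ) : Prop :=
  ∀ w, w ≠ 0 → f.Q w ≠ 0 → (f.P w = a * f.Q w ↔ lam * w * f.W w = a * f.Q w ^ 2)

/-- The identity `R = λ w R'`, with denominators cleared. -/
def Fixed (lam : ℂ) : Prop := ∀ w, f.P w * f.Q w = lam * w * f.W w

/-- The coefficients of `w ↦ R (1 / w)`. Under this change of variable the operator `λ w d/dw`
changes its sign. -/
def rev : QuadPair := ⟨f.p2, f.p1, f.p0, f.q2, f.q1, f.q0⟩

variable {f}

theorem P_rev {w : ℂ} (hw : w ≠ 0) : f.rev.P w = w ^ 2 * f.P w⁻¹ := by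
  simp only [P, rev]; field_simp; ring

theorem Q_rev {w : ℂ} (hw : w ≠ 0) : f.rev.Q w = w ^ 2 * f.Q w⁻¹ := by
  simp only [Q, rev]; field_simp; ring

theorem W_rev {w : ℂ} (hw : w ≠ 0) : f.rev.W w = -(w ^ 2 * f.W w⁻¹) := by
  simp only [W, rev]; field_simp; ring

theorem Coprime.zero (h : f.Coprime) (h0 : f.p0 = 0) : f.q0 ≠ 0 := by
  simpa [P, Q, h0] using h.finite 0

theorem Coprime.rev (h : f.Coprime) : f.rev.Coprime := by
  refine ⟨fun w hP hQ => ?_, h.zero⟩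
  rcases eq_or_ne w 0 with rfl | hw
  · simp only [P, Q, QuadPair.rev] at hP hQ
    exact h.infinity (by simpa using hP) (by simpa using hQ)
  · rw [P_rev hw] at hP
    rw [Q_rev hw] at hQ
    have hw2 : w ^ 2 ≠ 0 := pow_ne_zero 2 hw
    exact h.finite _ ((mul_eq_zero.1 hP).resolve_left hw2) ((mul_eq_zero.1 hQ).resolve_left hw2)

theorem Shares.rev {lam a : ℂ} (h : f.Shares lam a) : f.rev.Shares (-lam) a := by
  intro w hw hQ
  rw [Q_rev hw] at hQ
  have hw2 : w ^ 2 ≠ 0 := pow_ne_zero 2 hw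
  have key := h w⁻¹ (inv_ne_zero hw) (right_ne_zero_of_mul hQ)
  rw [P_rev hw, Q_rev hw, W_rev hw]
  have e1 : w ^ 2 * f.P w⁻¹ = a * (w ^ 2 * f.Q w⁻¹) ↔ f.P w⁻¹ = a * f.Q w⁻¹ := by
    rw [mul_left_comm, mul_right_inj' hw2]
  have e2 : -lam * w * -(w ^ 2 * f.W w⁻¹) = a * (w ^ 2 * f.Q w⁻¹) ^ 2 ↔
      lam * w⁻¹ * f.W w⁻¹ = a * f.Q w⁻¹ ^ 2 := by
    rw [← mul_right_inj' (pow_ne_zero 4 hw) (b := lam * w⁻¹ * f.W w⁻¹)]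
    have : w ^ 4 * (lam * w⁻¹ * f.W w⁻¹) = -lam * w * -(w ^ 2 * f.W w⁻¹) := by
      field_simp
    rw [this, show w ^ 4 * (a * f.Q w⁻¹ ^ 2) = a * (w ^ 2 * f.Q w⁻¹) ^ 2 by ring]
  rw [e1, e2, key]

/-- `W` does not change when a multiple of `Q` is subtracted from `P`. -/
theorem W_eq (a w : ℂ) : f.W w =
    ((f.p1 - a * f.q1) + 2 * (f.p2 - a * f.q2) * w) * f.Q w -
      (f.P w - a * f.Q w) * (f.q1 + 2 * f.q2 * w) := by
  simp only [P, Q, W]; ring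

theorem rev_rev : f.rev.rev = f := rfl

theorem Fixed.rev {lam : ℂ} (h : f.Fixed lam) : f.rev.Fixed (-lam) := by
  intro w
  rcases eq_or_ne w 0 with rfl | hw
  · -- the leading coefficient of the identity, read off from five values
    have h0 := h 0; have h1 := h 1; have h2 := h (-1); have h3 := h 2; have h4 := h (-2)
    simp only [P, Q, W, QuadPair.rev] at *
    linear_combination (1 / 4) * h0 - (1 / 6) * h1 - (1 / 6) * h2 + (1 / 24) * h3 + (1 / 24) * h4
  · rw [P_rev hw, Q_rev hw, W_rev hw]
    have := h w⁻¹
    field_simp at this ⊢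
    linear_combination this

variable {lam a b : ℂ}

theorem W_ne_zero_of_simple_pole (h : f.Coprime) {x : ℂ} (hQ : f.Q x = 0)
    (hx : f.q1 + 2 * f.q2 * x ≠ 0) : f.W x ≠ 0 := by
  have hP : f.P x ≠ 0 := fun hP => h.finite x hP hQ
  rw [W_eq 0, hQ]
  simpa using ⟨hP, hx⟩

/-- In `ℂ \ {0}`, a zero of the numerator of `λ w R' - a` is an `a`-point of `R` or a double
pole. -/
theorem Shares.root (hs : f.Shares lam a) (h : f.Coprime) (hlam : lam ≠ 0) {x : ℂ} (hx : x ≠ 0)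
    (hF : lam * x * f.W x = a * f.Q x ^ 2) :
    (f.Q x ≠ 0 ∧ f.P x = a * f.Q x) ∨ (f.Q x = 0 ∧ f.q1 + 2 * f.q2 * x = 0) := by
  by_cases hQ : f.Q x = 0
  · refine .inr ⟨hQ, ?_⟩
    by_contra hne
    have := W_ne_zero_of_simple_pole h hQ hne
    rw [hQ] at hF
    simp_all
  · exact .inl ⟨hQ, (hs x hx hQ).2 hF⟩

/-! ### Nonzero shared values -/

/-- `R` does not take a nonzero shared value at `0`. With `P = a Q + w (g1 + g2 w)`, the only
possible `a`-point in `ℂ \ {0}` is `-g1 / g2`; so this is the only zero of `λ w W - a Q ^ 2`, except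
for a simple zero at a finite double pole. The cases are the possible multiplicities of the poles. -/
theorem Shares.value_zero_ne (hs : f.Shares lam a) (h : f.Coprime) (hlam : lam ≠ 0)
    (ha : a ≠ 0) : f.p0 ≠ a * f.q0 := by
  intro h0
  have hq0 : f.q0 ≠ 0 := fun hq => h.zero (by simp [h0, hq]) hq
  obtain ⟨g1, hg1⟩ : ∃ g1, f.p1 = a * f.q1 + g1 := ⟨f.p1 - a * f.q1, by ring⟩
  obtain ⟨g2, hg2⟩ : ∃ g2, f.p2 = a * f.q2 + g2 := ⟨f.p2 - a * f.q2, by ring⟩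
  have hW : ∀ w, f.W w = g1 * f.q0 + 2 * g2 * f.q0 * w + (g2 * f.q1 - g1 * f.q2) * w ^ 2 := by
    intro w; simp only [W, h0, hg1, hg2]; ring
  have hG : ∀ w, f.P w - a * f.Q w = w * (g1 + g2 * w) := by
    intro w; simp only [P, Q, h0, hg1, hg2]; ring
  have hQ : ∀ w, f.Q w = f.q0 + f.q1 * w + f.q2 * w ^ 2 := fun w => rfl
  have hroot : ∀ x, x ≠ 0 → lam * x * f.W x = a * f.Q x ^ 2 →
      (f.Q x ≠ 0 ∧ g1 + g2 * x = 0) ∨ (f.Q x = 0 ∧ f.q1 + 2 * f.q2 * x = 0) := by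
    intro x hx hF
    refine (hs.root h hlam hx hF).imp_left fun ⟨h1, h2⟩ => ⟨h1, ?_⟩
    exact (mul_eq_zero.1 ((hG x).symm.trans (sub_eq_zero.2 h2))).resolve_left hx
  have hg : g2 = 0 → g1 ≠ 0 := by
    intro h2 h1
    by_cases hq2 : f.q2 = 0
    · exact h.infinity (by simp [hg2, h2, hq2]) hq2
    · obtain ⟨x, y, hx, hy⟩ := exists_factor_quadratic hq2 f.q0 f.q1
      have hQx : f.Q x = 0 := by rw [hQ]; rw [hx, hy]; ring
      refine h.finite x ?_ hQx
      have := hG x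
      rw [hQx, h1, h2] at this
      simpa using this
  by_cases hq2 : f.q2 = 0
  · have hg2' : g2 ≠ 0 := fun h2 => h.infinity (by simp [hg2, h2, hq2]) hq2
    by_cases hq1 : f.q1 = 0
    · -- a double pole at infinity
      obtain ⟨x, y, hx, hy⟩ := exists_factor_quadratic
        (c2 := 2 * lam * g2 * f.q0) (by simp [hlam, hg2', hq0]) (-a * f.q0 ^ 2) (lam * g1 * f.q0)
      have hF : ∀ w, lam * w * f.W w - a * f.Q w ^ 2 =
          2 * lam * g2 * f.q0 * ((w - x) * (w - y)) := by
        intro w; rw [hW, hQ, hq1, hq2]; linear_combination w * hx + hy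
      have hxy : x * y ≠ 0 := by
        rintro h0; rw [h0] at hy; simp [ha, hq0] at hy
      have key : ∀ x, x ≠ 0 → lam * x * f.W x - a * f.Q x ^ 2 = 0 → g1 = -g2 * x := by
        intro x hx hF
        rcases hroot x hx (sub_eq_zero.1 hF) with h1 | h1
        · linear_combination h1.2
        · exact absurd h1.1 (by simp [hQ, hq1, hq2, hq0])
      have kx := key x (left_ne_zero_of_mul hxy) (by rw [hF]; ring)
      have ky := key y (right_ne_zero_of_mul hxy) (by rw [hF]; ring)
      obtain rfl : x = y := mul_left_cancel₀ hg2' (by linear_combination kx - ky)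
      rw [kx] at hx
      have : 3 * (lam * g2 * f.q0 * x) = 0 := by linear_combination hx
      simp [hlam, hg2', hq0, left_ne_zero_of_mul hxy] at this
    · -- a simple pole at infinity
      obtain ⟨x, y, z, h2, h1, h00⟩ := exists_factor_cubic
        (c3 := lam * g2 * f.q1) (by simp [hlam, hg2', hq1]) (-a * f.q0 ^ 2)
        (lam * g1 * f.q0 - 2 * a * f.q0 * f.q1) (2 * lam * g2 * f.q0 - a * f.q1 ^ 2)
      have hF : ∀ w, lam * w * f.W w - a * f.Q w ^ 2 =
          lam * g2 * f.q1 * ((w - x) * (w - y) * (w - z)) := by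
        intro w; rw [hW, hQ, hq2]; linear_combination w ^ 2 * h2 + w * h1 + h00
      have hxy : x * y * z ≠ 0 := by
        rintro h0; rw [h0] at h00; simp [ha, hq0] at h00
      have key : ∀ x, x ≠ 0 → lam * x * f.W x - a * f.Q x ^ 2 = 0 →
          g1 = -g2 * x ∧ f.Q x ≠ 0 := by
        intro x hx hF
        rcases hroot x hx (sub_eq_zero.1 hF) with h1 | h1
        · exact ⟨by linear_combination h1.2, h1.1⟩
        · exact absurd h1.2 (by simp [hq2, hq1])
      have kx := key x (left_ne_zero_of_mul (left_ne_zero_of_mul hxy)) (by rw [hF]; ring)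
      have ky := key y (right_ne_zero_of_mul (left_ne_zero_of_mul hxy)) (by rw [hF]; ring)
      have kz := key z (right_ne_zero_of_mul hxy) (by rw [hF]; ring)
      obtain rfl : x = y := mul_left_cancel₀ hg2' (by linear_combination kx.1 - ky.1)
      obtain rfl : x = z := mul_left_cancel₀ hg2' (by linear_combination kx.1 - kz.1)
      have hx0 := right_ne_zero_of_mul hxy
      have hQx := kx.2
      rw [hQ, hq2] at hQx
      rw [kx.1] at h1
      clear hW hG hQ hroot hF key kx ky kz
      have hL : lam * g2 ≠ 0 := mul_ne_zero hlam hg2'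
      have e1 : lam * g2 * ((4 * f.q0 + 3 * f.q1 * x) * (f.q0 + f.q1 * x)) = 0 := by
        linear_combination 2 * f.q0 * h2 - f.q1 * h1
      have e2 : 4 * f.q0 + 3 * f.q1 * x = 0 := by
        refine ((mul_eq_zero.1 e1).resolve_left hL |> mul_eq_zero.1).resolve_right fun h' => hQx ?_
        linear_combination h'
      have e3 : lam * g2 * ((2 * f.q0 + 3 * f.q1 * x) * f.q0 ^ 2 - (f.q1 * x) ^ 3) = 0 := by
        linear_combination f.q0 ^ 2 * h2 - f.q1 ^ 2 * h00
      have e4 := (mul_eq_zero.1 e3).resolve_left hL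
      have e5 : f.q0 = -3 / 4 * (f.q1 * x) := by linear_combination e2 / 4
      rw [e5] at e4
      have : (f.q1 * x) ^ 3 = 0 := by linear_combination (-32 / 5) * e4
      simp [hq1, hx0] at this
  · by_cases hd : f.q1 ^ 2 = 4 * f.q0 * f.q2
    · -- a double pole at a finite point `u`
      obtain ⟨u, hu⟩ : ∃ u, f.q1 = -2 * f.q2 * u := ⟨-f.q1 / (2 * f.q2), by field_simp⟩
      have hu0 : f.q0 = f.q2 * u ^ 2 := by
        apply mul_left_cancel₀ hq2
        rw [hu] at hd; linear_combination (-1 / 4) * hd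
      have hu1 : u ≠ 0 := by rintro rfl; simp [hu0] at hq0
      have hQu : ∀ w, f.Q w = f.q2 * (w - u) ^ 2 := by
        intro w; rw [hQ, hu, hu0]; ring
      have hGu : g1 + g2 * u ≠ 0 := by
        intro h1
        have := hG u
        rw [h1, hQu] at this
        exact h.finite u (by simpa using this) (by rw [hQu]; ring)
      obtain ⟨x, y, z, h2, h1, h00⟩ := exists_factor_cubic
        (c3 := -a * f.q2) (by simp [ha, hq2]) (a * f.q2 * u ^ 3)
        (-lam * g1 * u - 3 * a * f.q2 * u ^ 2) (lam * (-g1 - 2 * g2 * u) + 3 * a * f.q2 * u)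
      have hF : ∀ w, lam * w * f.W w - a * f.Q w ^ 2 =
          f.q2 * (w - u) * (-a * f.q2 * ((w - x) * (w - y) * (w - z))) := by
        intro w; rw [hW, hQ, hu, hu0]
        linear_combination f.q2 * (w - u) * (w ^ 2 * h2 + w * h1 + h00)
      have hxy : x * y * z ≠ 0 := by
        rintro h0; rw [h0] at h00; simp [ha, hq2, hu1] at h00
      have hne : (u - x) * (u - y) * (u - z) ≠ 0 := by
        intro h0
        have : -2 * lam * u ^ 2 * (g1 + g2 * u) = 0 := by
          linear_combination u ^ 2 * h2 + u * h1 + h00 - a * f.q2 * h0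
        simp [hlam, hu1, hGu] at this
      have key : ∀ x, x ≠ 0 → u - x ≠ 0 → lam * x * f.W x - a * f.Q x ^ 2 = 0 →
          g1 = -g2 * x := by
        intro x hx hux hF
        rcases hroot x hx (sub_eq_zero.1 hF) with h1 | h1
        · linear_combination h1.2
        · refine absurd h1.1 ?_
          rw [hQu]
          exact mul_ne_zero hq2 (pow_ne_zero 2 (by rwa [← neg_sub, neg_ne_zero]))
      have kx := key x (left_ne_zero_of_mul (left_ne_zero_of_mul hxy))
        (left_ne_zero_of_mul (left_ne_zero_of_mul hne)) (by rw [hF]; ring)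
      have ky := key y (right_ne_zero_of_mul (left_ne_zero_of_mul hxy))
        (right_ne_zero_of_mul (left_ne_zero_of_mul hne)) (by rw [hF]; ring)
      have kz := key z (right_ne_zero_of_mul hxy)
        (right_ne_zero_of_mul hne) (by rw [hF]; ring)
      have hg2' : g2 ≠ 0 := fun h2 => hg h2 (by simpa [h2] using kx)
      obtain rfl : x = y := mul_left_cancel₀ hg2' (by linear_combination kx - ky)
      obtain rfl : x = z := mul_left_cancel₀ hg2' (by linear_combination kx - kz)
      have hx0 := right_ne_zero_of_mul hxy
      have hux := right_ne_zero_of_mul hne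
      rw [kx] at h1 h2
      clear hW hG hQ hroot hF key kx ky kz
      have hL : lam * g2 ≠ 0 := mul_ne_zero hlam hg2'
      have e1 : lam * g2 * (x ^ 2 - 2 * u ^ 2) = 0 := by
        linear_combination (x + u) * h2 + h1
      have e2 := (mul_eq_zero.1 e1).resolve_left hL
      have e3 : a * f.q2 * (u ^ 3 - x ^ 3) = 0 := by linear_combination h00
      have e4 : u ^ 3 - x ^ 3 = 0 := (mul_eq_zero.1 e3).resolve_left (mul_ne_zero ha hq2)
      have : u ^ 6 = 0 := by
        linear_combination (-1 / 7) * (x ^ 4 + 2 * x ^ 2 * u ^ 2 + 4 * u ^ 4) * e2 -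
          (1 / 7) * (u ^ 3 + x ^ 3) * e4
      exact hu1 (pow_eq_zero_iff (by norm_num) |>.1 this)
    · -- no double pole
      obtain ⟨x, y, z, t, h3, h2, h1, h00⟩ := exists_factor_quartic
        (c4 := -a * f.q2 ^ 2) (by simp [ha, hq2]) (-a * f.q0 ^ 2)
        (lam * g1 * f.q0 - 2 * a * f.q0 * f.q1)
        (2 * lam * g2 * f.q0 - a * (f.q1 ^ 2 + 2 * f.q0 * f.q2))
        (lam * (g2 * f.q1 - g1 * f.q2) - 2 * a * f.q1 * f.q2)
      have hF : ∀ w, lam * w * f.W w - a * f.Q w ^ 2 =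
          -a * f.q2 ^ 2 * ((w - x) * (w - y) * (w - z) * (w - t)) := by
        intro w; rw [hW, hQ]; linear_combination w ^ 3 * h3 + w ^ 2 * h2 + w * h1 + h00
      have hxy : x * y * z * t ≠ 0 := by
        rintro h0; rw [h0] at h00; simp [ha, hq0] at h00
      have key : ∀ x, x ≠ 0 → lam * x * f.W x - a * f.Q x ^ 2 = 0 →
          g1 = -g2 * x ∧ f.Q x ≠ 0 := by
        intro x hx hF
        rcases hroot x hx (sub_eq_zero.1 hF) with h1 | ⟨h1, h2⟩
        · exact ⟨by linear_combination h1.2, h1.1⟩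
        · refine absurd ?_ hd
          rw [hQ] at h1
          linear_combination (f.q1 + 2 * f.q2 * x) * h2 - 4 * f.q2 * h1
      have ht0 := right_ne_zero_of_mul hxy
      have kx := key x (left_ne_zero_of_mul (left_ne_zero_of_mul (left_ne_zero_of_mul hxy)))
        (by rw [hF]; ring)
      have ky := key y (right_ne_zero_of_mul (left_ne_zero_of_mul (left_ne_zero_of_mul hxy)))
        (by rw [hF]; ring)
      have kz := key z (right_ne_zero_of_mul (left_ne_zero_of_mul hxy)) (by rw [hF]; ring)
      have kt := key t (right_ne_zero_of_mul hxy) (by rw [hF]; ring)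
      have hg2' : g2 ≠ 0 := fun h2 => hg h2 (by simpa [h2] using kx.1)
      obtain rfl : x = y := mul_left_cancel₀ hg2' (by linear_combination kx.1 - ky.1)
      obtain rfl : x = z := mul_left_cancel₀ hg2' (by linear_combination kx.1 - kz.1)
      obtain rfl : x = t := mul_left_cancel₀ hg2' (by linear_combination kx.1 - kt.1)
      have hQx := kx.2
      rw [hQ] at hQx
      rw [kx.1] at h1 h3
      clear hW hG hQ hroot hF key kx ky kz kt
      have e0 : a * ((f.q0 - f.q2 * x ^ 2) * (f.q0 + f.q2 * x ^ 2)) = 0 := by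
        linear_combination -h00
      rcases mul_eq_zero.1 ((mul_eq_zero.1 e0).resolve_left ha) with e | e
      · have e1 : f.q2 * x ^ 2 * (lam * g2 * x + 2 * a * (f.q1 + 2 * f.q2 * x)) = 0 := by
          linear_combination -h1 - (lam * g2 * x + 2 * a * f.q1) * e
        have e2 := (mul_eq_zero.1 e1).resolve_left (mul_ne_zero hq2 (pow_ne_zero 2 ht0))
        have e3 : lam * g2 * (f.q1 + 2 * f.q2 * x) = 0 := by
          linear_combination h3 + f.q2 * e2
        have e4 := (mul_eq_zero.1 e3).resolve_left (mul_ne_zero hlam hg2')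
        exact hQx (by linear_combination e + x * e4)
      · have e1 : f.q2 * x ^ 2 * (lam * g2 * x + 2 * a * f.q1 - 4 * a * f.q2 * x) = 0 := by
          linear_combination h1 + (lam * g2 * x + 2 * a * f.q1) * e
        have e2 := (mul_eq_zero.1 e1).resolve_left (mul_ne_zero hq2 (pow_ne_zero 2 ht0))
        have e3 : 2 * a * f.q1 ^ 2 = 0 := by
          linear_combination -x * h3 + (f.q1 + f.q2 * x) * e2
        have e4 : f.q1 = 0 := by simpa [ha] using e3
        exact hQx (by linear_combination e + x * e4)

theorem Shares.value_infinity_ne (hs : f.Shares lam a) (h : f.Coprime) (hlam : lam ≠ 0)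
    (ha : a ≠ 0) : f.p2 ≠ a * f.q2 :=
  hs.rev.value_zero_ne h.rev (neg_ne_zero.2 hlam) ha

/-- If `a ≠ 0` is shared, then `R` has exactly two `a`-points on the sphere, both in
`ℂ \ {0}`. -/
theorem Shares.exists_points (hs : f.Shares lam a) (h : f.Coprime) (hlam : lam ≠ 0)
    (ha : a ≠ 0) : ∃ u v, u ≠ v ∧ u ≠ 0 ∧ v ≠ 0 ∧ f.Q u ≠ 0 ∧ f.Q v ≠ 0 ∧
      f.P u = a * f.Q u ∧ f.P v = a * f.Q v ∧
      lam * u * f.W u = a * f.Q u ^ 2 ∧ lam * v * f.W v = a * f.Q v ^ 2 ∧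
      f.p1 - a * f.q1 = -(f.p2 - a * f.q2) * (u + v) ∧
      ∀ w, f.P w - a * f.Q w = (f.p2 - a * f.q2) * ((w - u) * (w - v)) := by
  have h0 := sub_ne_zero.2 (hs.value_zero_ne h hlam ha)
  have h2 := sub_ne_zero.2 (hs.value_infinity_ne h hlam ha)
  obtain ⟨u, v, e1, e0⟩ := exists_factor_quadratic h2 (f.p0 - a * f.q0) (f.p1 - a * f.q1)
  have hG : ∀ w, f.P w - a * f.Q w = (f.p2 - a * f.q2) * ((w - u) * (w - v)) := by
    intro w; simp only [P, Q]; linear_combination w * e1 + e0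
  have huv : u * v ≠ 0 := by intro h'; rw [h'] at e0; exact h0 (by simpa using e0)
  have hu := left_ne_zero_of_mul huv
  have hv := right_ne_zero_of_mul huv
  have hPu : f.P u = a * f.Q u := by have := hG u; linear_combination this
  have hPv : f.P v = a * f.Q v := by have := hG v; linear_combination this
  have hQu : f.Q u ≠ 0 := fun hQ => h.finite u (by rw [hPu, hQ, mul_zero]) hQ
  have hQv : f.Q v ≠ 0 := fun hQ => h.finite v (by rw [hPv, hQ, mul_zero]) hQ
  have hFu := (hs u hu hQu).1 hPu
  refine ⟨u, v, ?_, hu, hv, hQu, hQv, hPu, hPv, hFu, (hs v hv hQv).1 hPv, e1, hG⟩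
  rintro rfl
  -- a double `a`-point would be a zero of the derivative
  have hW : f.W u = 0 := by
    rw [W_eq a, hPu, e1]; ring
  rw [hW, mul_zero, eq_comm] at hFu
  simp [ha, hQu] at hFu

/-- If two nonzero values are shared, the Riccati equation that `R` satisfies reduces to
`λ w R' = R`. -/
theorem fixed_of_shares (h : f.Coprime) (hlam : lam ≠ 0) (ha : a ≠ 0) (hb : b ≠ 0)
    (hab : a ≠ b) (hsa : f.Shares lam a) (hsb : f.Shares lam b) : f.Fixed lam := by
  obtain ⟨x, y, hxy, -, -, hQx, hQy, hPx, hPy, hFx, hFy, -, hGa⟩ := hsa.exists_points h hlam ha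
  obtain ⟨z, t, hzt, -, -, hQz, hQt, hPz, hPt, hFz, hFt, -, hGb⟩ := hsb.exists_points h hlam hb
  have hne : ∀ u v, f.Q u ≠ 0 → f.P u = a * f.Q u → f.P v = b * f.Q v → u ≠ v := by
    rintro u v hQ h1 h2 rfl
    exact hab (mul_right_cancel₀ hQ (h1.symm.trans h2))
  have hga := sub_ne_zero.2 (hsa.value_infinity_ne h hlam ha)
  have hgb := sub_ne_zero.2 (hsb.value_infinity_ne h hlam hb)
  have hD : ∀ w, f.P w * f.Q w - lam * w * f.W w =
      f.p0 * f.q0 + (f.p0 * f.q1 + f.p1 * f.q0 - lam * (f.p1 * f.q0 - f.p0 * f.q1)) * w +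
      (f.p0 * f.q2 + f.p1 * f.q1 + f.p2 * f.q0 - 2 * lam * (f.p2 * f.q0 - f.p0 * f.q2)) * w ^ 2 +
      (f.p1 * f.q2 + f.p2 * f.q1 - lam * (f.p2 * f.q1 - f.p1 * f.q2)) * w ^ 3 +
      f.p2 * f.q2 * w ^ 4 := by
    intro w; simp only [P, Q, W]; ring
  have key := quartic_eq_of_four_roots hxy (hne x z hQx hPx hPz) (hne x t hQx hPx hPt)
    (hne y z hQy hPy hPz) (hne y t hQy hPy hPt) hzt
    ((hD x).symm.trans (by rw [hPx, hFx]; ring)) ((hD y).symm.trans (by rw [hPy, hFy]; ring))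
    ((hD z).symm.trans (by rw [hPz, hFz]; ring)) ((hD t).symm.trans (by rw [hPt, hFt]; ring))
  obtain ⟨k, hk⟩ : ∃ k, f.p2 * f.q2 = k * ((f.p2 - a * f.q2) * (f.p2 - b * f.q2)) :=
    ⟨_, (div_mul_cancel₀ _ (mul_ne_zero hga hgb)).symm⟩
  -- the Riccati equation satisfied by `R`
  have hR : ∀ w, f.P w * f.Q w - lam * w * f.W w =
      k * ((f.P w - a * f.Q w) * (f.P w - b * f.Q w)) := by
    intro w
    rw [hD, key, hGa, hGb, hk]; ring
  rcases eq_or_ne k 0 with rfl | hk0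
  · intro w
    linear_combination hR w
  have step : ∀ c d, f.Shares lam c → c ≠ 0 → (∀ w, f.P w * f.Q w - lam * w * f.W w =
      k * ((f.P w - c * f.Q w) * (f.P w - d * f.Q w))) → f.p2 * f.q2 =
      k * ((f.p2 - c * f.q2) * (f.p2 - d * f.q2)) → k * (c - d) = 1 := by
    intro c d hs hc hR hk
    have hF : ∀ w, lam * w * f.W w - c * f.Q w ^ 2 =
        (f.P w - c * f.Q w) * (f.Q w - k * (f.P w - d * f.Q w)) := by
      intro w; linear_combination -hR w
    -- the value of `R` at which `1 - k (R - d)` vanishes is taken neither at `0` nor at `∞`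
    have e0 : f.q0 - k * (f.p0 - d * f.q0) ≠ 0 := by
      intro e0
      have h0 := hF 0
      simp only [P, Q] at h0
      have hq : c * f.q0 ^ 2 = 0 := by linear_combination -h0 - (f.p0 - c * f.q0) * e0
      have hq0 : f.q0 = 0 := by simpa [hc] using hq
      have hkp : k * f.p0 = 0 := by linear_combination -e0 + (1 + k * d) * hq0
      exact h.zero ((mul_eq_zero.1 hkp).resolve_left hk0) hq0
    have e2 : f.q2 - k * (f.p2 - d * f.q2) ≠ 0 := by
      intro e2
      have hq : c * f.q2 ^ 2 = 0 := by linear_combination hk - (f.p2 - c * f.q2) * e2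
      have hq2 : f.q2 = 0 := by simpa [hc] using hq
      have hkp : k * f.p2 = 0 := by linear_combination -e2 + (1 + k * d) * hq2
      exact h.infinity ((mul_eq_zero.1 hkp).resolve_left hk0) hq2
    obtain ⟨u, v, f1, f0⟩ := exists_factor_quadratic e2 (f.q0 - k * (f.p0 - d * f.q0))
      (f.q1 - k * (f.p1 - d * f.q1))
    have hu : u ≠ 0 := by rintro rfl; exact e0 (by rw [f0]; ring)
    have hu0 : f.Q u - k * (f.P u - d * f.Q u) = 0 := by
      simp only [P, Q]; linear_combination u * f1 + f0
    have hQu : f.Q u ≠ 0 := by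
      intro hQ
      rw [hQ] at hu0
      have hkp : k * f.P u = 0 := by linear_combination -hu0
      exact h.finite u ((mul_eq_zero.1 hkp).resolve_left hk0) hQ
    have hPu := (hs u hu hQu).2 (sub_eq_zero.1 (by rw [hF, hu0, mul_zero]))
    apply mul_right_cancel₀ hQu
    rw [hPu] at hu0
    linear_combination -hu0
  have h1 := step a b hsa ha hR hk
  have h2 := step b a hsb hb (fun w => by rw [hR]; ring) (by rw [hk]; ring)
  exfalso
  have : (2 : ℂ) = 0 := by linear_combination -h1 - h2
  norm_num at this

/-! ### The shared values `0` and `b` -/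

/-- `λ = √5 / 2`, and `R` is `b` times the square of `(A + B c w) / (1 + c w)`, where
`A = (1 - √5) / 2` and `B = (1 + √5) / 2`. -/
def ExceptionalOne (f : QuadPair) (lam b : ℂ) : Prop :=
  lam = Real.sqrt 5 / 2 ∧ ∃ c ≠ 0, ∀ w, f.P w * (1 + c * w) ^ 2 =
    b * ((1 - (Real.sqrt 5 : ℂ)) / 2 + (1 + (Real.sqrt 5 : ℂ)) / 2 * c * w) ^ 2 * f.Q w

/-- `λ = -1`, and `R = 2 b / (1 - c w ^ 2)`. -/
def ExceptionalTwo (f : QuadPair) (lam b : ℂ) : Prop :=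
  lam = -1 ∧ ∃ c ≠ 0, ∀ w, f.P w * (1 - c * w ^ 2) = b * 2 * f.Q w

/-- `R` is not constant. -/
theorem Coprime.exists_ne (h : f.Coprime) (k : ℂ) : ∃ w, f.P w ≠ k * f.Q w := by
  by_contra! H
  have h0 := H 0; have h1 := H 1; have h2 := H (-1)
  simp only [P, Q] at h0 h1 h2
  have e2 : f.p2 = k * f.q2 := by linear_combination h1 / 2 + h2 / 2 - h0
  have hq2 : f.q2 ≠ 0 := fun hq => h.infinity (by rw [e2, hq, mul_zero]) hq
  obtain ⟨x, y, f1, f0⟩ := exists_factor_quadratic hq2 f.q0 f.q1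
  have hQ : f.Q x = 0 := by simp only [Q]; linear_combination x * f1 + f0
  exact h.finite x (by rw [H, hQ, mul_zero]) hQ

/-- The functions `p0 / (q0 + q2 w ^ 2)`, which are Möbius transformations in the variable `w ^ 2`. -/
theorem even_of_infinity_zero (h : f.Coprime) (hlam : lam ≠ 0) (hb : b ≠ 0)
    (hp1 : f.p1 = 0) (hq1 : f.q1 = 0) (hp2 : f.p2 = 0) (hs : f.Shares lam b) :
    f.Fixed lam ∨ f.ExceptionalTwo lam b := by
  have hq2 := h.infinity hp2
  have hP : ∀ w, f.P w = f.p0 := by intro w; simp [P, hp1, hp2]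
  have hQ : ∀ w, f.Q w = f.q0 + f.q2 * w ^ 2 := by intro w; simp [Q, hq1]
  have hW : ∀ w, f.W w = -2 * f.p0 * f.q2 * w := by intro w; simp only [W, hp1, hq1, hp2]; ring
  have hp0 : f.p0 ≠ 0 := by
    intro hp0
    obtain ⟨w, hw⟩ := h.exists_ne 0
    exact hw (by rw [hP, hp0, zero_mul])
  obtain ⟨x, y, e1, e0⟩ := exists_factor_quadratic (c2 := -b * f.q2 ^ 2) (by simp [hb, hq2])
    (-b * f.q0 ^ 2) (-2 * lam * f.p0 * f.q2 - 2 * b * f.q0 * f.q2)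
  -- in the variable `w ^ 2`, each nonzero root of the quadratic is the `b`-point of `R`
  have key : ∀ x, x ≠ 0 → -2 * lam * f.p0 * f.q2 * x - b * (f.q0 + f.q2 * x) ^ 2 = 0 →
      f.p0 = b * (f.q0 + f.q2 * x) := by
    intro x hx hF
    obtain ⟨w, hw⟩ := IsAlgClosed.exists_pow_nat_eq x (n := 2) (by norm_num)
    have hw0 : w ≠ 0 := by rintro rfl; exact hx (by rw [← hw]; ring)
    have hQw : f.Q w ≠ 0 := by
      intro h0
      rw [hQ, hw] at h0
      rw [h0] at hF
      simp [hlam, hp0, hq2, hx] at hF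
    have := (hs w hw0 hQw).2 (by rw [hQ, hW, hw]; subst hw; linear_combination hF)
    rwa [hP, hQ, hw] at this
  have hx1 : -2 * lam * f.p0 * f.q2 * x - b * (f.q0 + f.q2 * x) ^ 2 = 0 := by
    linear_combination x * e1 + e0
  have hy1 : -2 * lam * f.p0 * f.q2 * y - b * (f.q0 + f.q2 * y) ^ 2 = 0 := by
    linear_combination y * e1 + e0
  by_cases hq0 : f.q0 = 0
  · left
    have hv : lam = -1 / 2 := by
      rw [hq0] at e1 e0
      have hxy : x * y = 0 := by
        have : b * f.q2 ^ 2 * (x * y) = 0 := by linear_combination e0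
        simpa [hb, hq2] using this
      have hne : x + y ≠ 0 := by
        intro h0; rw [h0] at e1; simp [hlam, hp0, hq2] at e1
      have aux : ∀ x, x ≠ 0 → -2 * lam * f.p0 * f.q2 - b * f.q2 ^ 2 * x = 0 →
          f.p0 = b * (f.q0 + f.q2 * x) → lam = -1 / 2 := by
        intro x hx h1 h2
        apply mul_left_cancel₀ (mul_ne_zero (mul_ne_zero two_ne_zero hp0) hq2)
        rw [hq0] at h2
        linear_combination -h1 + f.q2 * h2
      rcases mul_eq_zero.1 hxy with rfl | rfl
      · rw [zero_add] at hne
        exact aux y hne (by linear_combination e1) (key y hne hy1)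
      · rw [add_zero] at hne
        exact aux x hne (by linear_combination e1) (key x hne hx1)
    intro w
    rw [hP, hQ, hW, hq0, hv]; ring
  · right
    have hxy : x * y ≠ 0 := by
      intro h0; rw [h0] at e0; simp [hb, hq0] at e0
    have hx := left_ne_zero_of_mul hxy
    have kx := key x hx hx1
    have ky := key y (right_ne_zero_of_mul hxy) hy1
    obtain rfl : x = y := mul_left_cancel₀ (mul_ne_zero hb hq2) (by linear_combination ky - kx)
    have e2 : b * ((f.q2 * x - f.q0) * (f.q2 * x + f.q0)) = 0 := by linear_combination e0
    have e3 : f.q2 * x = f.q0 := by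
      rcases mul_eq_zero.1 ((mul_eq_zero.1 e2).resolve_left hb) with e | e
      · exact sub_eq_zero.1 e
      · exact absurd (by linear_combination kx + b * e) hp0
    have e4 : 4 * b * f.q0 * f.q2 * (lam + 1) = 0 := by
      linear_combination -e1 - 2 * lam * f.q2 * kx - (2 * lam + 2) * b * f.q2 * e3
    refine ⟨?_, -f.q2 / f.q0, by simp [hq0, hq2], fun w => ?_⟩
    · simp [hb, hq0, hq2] at e4
      linear_combination e4
    · rw [hP, hQ, kx, e3]
      field_simp
      ring

/-- The case in which `0` and `∞` are the critical points of `R`. -/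
theorem even (h : f.Coprime) (hlam : lam ≠ 0) (hb : b ≠ 0) (hp1 : f.p1 = 0) (hq1 : f.q1 = 0)
    (hs0 : f.Shares lam 0) (hs : f.Shares lam b) :
    f.Fixed lam ∨ f.ExceptionalTwo lam b ∨ f.rev.ExceptionalTwo (-lam) b := by
  by_cases hp2 : f.p2 = 0
  · exact (even_of_infinity_zero h hlam hb hp1 hq1 hp2 hs).imp_right .inl
  by_cases hp0 : f.p0 = 0
  · refine (even_of_infinity_zero h.rev (neg_ne_zero.2 hlam) hb hp1 hq1 hp0 hs.rev).imp
      (fun h => ?_) .inr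
    simpa [rev_rev] using h.rev
  -- otherwise `R` has a simple zero
  exfalso
  obtain ⟨x, hx⟩ := IsAlgClosed.exists_pow_nat_eq (-f.p0 / f.p2) (n := 2) (by norm_num)
  have hx0 : x ≠ 0 := by
    rintro rfl
    rw [eq_div_iff hp2] at hx
    exact hp0 (by linear_combination hx)
  have hPx : f.P x = 0 := by
    simp only [P, hx, hp1]; field_simp; ring
  have hQx := h.finite x hPx
  have hF := (hs0 x hx0 hQx).1 (by rw [hPx, zero_mul])
  rw [W_eq 0, hPx, hp1, hq1] at hF
  have : 2 * lam * x ^ 2 * f.p2 * f.Q x = 0 := by linear_combination hF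
  simp [hlam, hx0, hp2, hQx] at this

/-- If `0` is shared, a critical point of `R` in `ℂ \ {0}` is a double zero or a double pole. -/
theorem double_of_critical (h : f.Coprime) (hs0 : f.Shares lam 0) {x : ℂ} (hx : x ≠ 0)
    (hW : f.W x = 0) : (f.P x = 0 ∧ f.p1 + 2 * f.p2 * x = 0) ∨
      (f.Q x = 0 ∧ f.q1 + 2 * f.q2 * x = 0) := by
  by_cases hQ : f.Q x = 0
  · exact .inr ⟨hQ, by_contra fun hne => W_ne_zero_of_simple_pole h hQ hne hW⟩
  · left
    have hP : f.P x = 0 := by simpa using (hs0 x hx hQ).2 (by rw [hW]; ring)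
    refine ⟨hP, ?_⟩
    rw [W_eq 0, hP] at hW
    simpa [hQ] using hW

/-- It is impossible that `∞` is a critical point of `R` and `0` is not. The remaining critical
point `x ≠ 0` is the midpoint of the two `b`-points, because `R` is a function of `(w - x) ^ 2`. -/
theorem not_critical_infinity (h : f.Coprime) (hlam : lam ≠ 0) (hb : b ≠ 0)
    (hs0 : f.Shares lam 0) (hs : f.Shares lam b)
    (h2 : f.p2 * f.q1 - f.p1 * f.q2 = 0) (h0 : f.p1 * f.q0 - f.p0 * f.q1 ≠ 0) : False := by
  obtain ⟨c, hc⟩ : ∃ c, c = 2 * (f.p2 * f.q0 - f.p0 * f.q2) := ⟨_, rfl⟩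
  have hc0 : c ≠ 0 := by
    rintro rfl
    have ep : f.p2 * (f.p1 * f.q0 - f.p0 * f.q1) = 0 := by
      linear_combination (-f.p1 / 2) * hc - f.p0 * h2
    have eq : f.q2 * (f.p1 * f.q0 - f.p0 * f.q1) = 0 := by
      linear_combination (-f.q1 / 2) * hc - f.q0 * h2
    exact h.infinity ((mul_eq_zero.1 ep).resolve_right h0) ((mul_eq_zero.1 eq).resolve_right h0)
  obtain ⟨x, hx⟩ : ∃ x, f.p1 * f.q0 - f.p0 * f.q1 = -c * x :=
    ⟨-(f.p1 * f.q0 - f.p0 * f.q1) / c, by field_simp⟩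
  have hx0 : x ≠ 0 := by rintro rfl; exact h0 (by rw [hx, mul_zero])
  have hW : ∀ w, f.W w = c * (w - x) := by
    intro w; simp only [W]; linear_combination hx - w * hc + w ^ 2 * h2
  obtain ⟨u, v, huv, hu, hv, hQu, hQv, hPu, hPv, hFu, hFv, e1, hG⟩ := hs.exists_points h hlam hb
  have hne := sub_ne_zero.2 (hs.value_infinity_ne h hlam hb)
  rcases double_of_critical h hs0 hx0 (by rw [hW]; ring) with ⟨hPx, hx1⟩ | ⟨hQx, hx1⟩
  · -- a double zero at `x`
    have hQx := h.finite x hPx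
    have hp2 : f.p2 ≠ 0 := by
      intro hp2
      have hp1 : f.p1 = 0 := by simpa [hp2] using hx1
      have hp0 : f.p0 = 0 := by simpa [P, hp1, hp2] using hPx
      simp [hp0, hp1] at h0
    have hp1 : f.p1 = -2 * f.p2 * x := by linear_combination hx1
    have hq1 : f.q1 = -2 * f.q2 * x := by
      apply mul_left_cancel₀ hp2
      linear_combination h2 + f.q2 * hp1
    have huv2 : u + v = 2 * x := by
      apply mul_left_cancel₀ hne
      linear_combination e1 - hp1 + b * hq1
    have hF : ∀ w, lam * w * f.W w - b * f.Q w ^ 2 =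
        -b * f.q0 ^ 2 + (-lam * c * x + 4 * b * f.q0 * f.q2 * x) * w +
        (lam * c - b * (4 * f.q2 ^ 2 * x ^ 2 + 2 * f.q0 * f.q2)) * w ^ 2 +
        4 * b * f.q2 ^ 2 * x * w ^ 3 + -b * f.q2 ^ 2 * w ^ 4 := by
      intro w; rw [hW]; simp only [Q, hq1]; ring
    have hu1 := (hF u).symm.trans (sub_eq_zero.2 hFu)
    have hv1 := (hF v).symm.trans (sub_eq_zero.2 hFv)
    have hd := quartic_dividedDifference huv hu1 hv1
    -- as `u + v = 2 x`, all terms of this divided difference but one cancel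
    obtain rfl : v = 2 * x - u := by linear_combination huv2
    have : lam * c * x = 0 := by linear_combination hd
    simp [hlam, hc0, hx0] at this
  · -- a double pole at `x`
    have hq2 : f.q2 ≠ 0 := by
      intro hq2
      have hq1 : f.q1 = 0 := by simpa [hq2] using hx1
      have hq0 : f.q0 = 0 := by simpa [Q, hq1, hq2] using hQx
      simp [hq0, hq1] at h0
    have hq1 : f.q1 = -2 * f.q2 * x := by linear_combination hx1
    have hq0 : f.q0 = f.q2 * x ^ 2 := by
      simp only [Q] at hQx; linear_combination hQx - x * hq1
    have hp1 : f.p1 = -2 * f.p2 * x := by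
      apply mul_left_cancel₀ hq2
      linear_combination -h2 + f.p2 * hq1
    -- otherwise `P` has a nonzero zero, which is double, hence critical, hence equal to `x`
    have hp2 : f.p2 = 0 := by
      by_contra hp2
      obtain ⟨s, t, f1, f0⟩ := exists_factor_quadratic hp2 f.p0 f.p1
      have hst : s + t = 2 * x := by
        apply mul_left_cancel₀ hp2
        linear_combination f1 - hp1
      have aux : ∀ s, f.P s = 0 → s = 0 := by
        intro s hPs
        by_contra hs
        have hQs := h.finite s hPs
        have := (hs0 s hs hQs).1 (by rw [hPs, zero_mul])
        rw [hW] at this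
        have hsx : s = x := by simpa [hlam, hs, hc0, sub_eq_zero] using this
        exact hQs (hsx ▸ hQx)
      have e1 := aux s (by simp only [P]; linear_combination s * f1 + f0)
      have e2 := aux t (by simp only [P]; linear_combination t * f1 + f0)
      rw [e1, e2] at hst
      exact hx0 (by linear_combination -hst / 2)
    rw [hp2] at hc hp1 e1 hne
    have huv2 : u + v = 2 * x := by
      apply mul_left_cancel₀ (mul_ne_zero hb hq2)
      linear_combination -e1 + hp1 - b * hq1
    have hF : ∀ w, lam * w * f.W w - b * f.Q w ^ 2 = f.q2 * (w - x) *
        (b * f.q2 * x ^ 3 + (-2 * lam * f.p0 - 3 * b * f.q2 * x ^ 2) * w +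
          3 * b * f.q2 * x * w ^ 2 + -b * f.q2 * w ^ 3 + 0 * w ^ 4) := by
      intro w; rw [hW, hc]; simp only [Q, hq1, hq0]; ring
    have hQ : ∀ w, f.Q w = f.q2 * (w - x) ^ 2 := by
      intro w; simp only [Q, hq1, hq0]; ring
    have aux : ∀ w, f.Q w ≠ 0 → lam * w * f.W w = b * f.Q w ^ 2 →
        b * f.q2 * x ^ 3 + (-2 * lam * f.p0 - 3 * b * f.q2 * x ^ 2) * w +
          3 * b * f.q2 * x * w ^ 2 + -b * f.q2 * w ^ 3 + 0 * w ^ 4 = 0 := by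
      intro w hw hFw
      have := hF w
      rw [hFw, sub_self, eq_comm, mul_eq_zero] at this
      refine this.resolve_left (mul_ne_zero hq2 fun hwx => hw ?_)
      rw [hQ, hwx]; ring
    -- the third zero of this cubic polynomial is `3 x - u - v = x`, where it does not vanish
    have key := quartic_eq_of_two_roots huv (aux u hQu hFu) (aux v hQv hFv) x
    have : lam * f.p0 * x = 0 := by
      linear_combination -key / 2 + (x - u) * (x - v) * b * f.q2 / 2 * huv2
    rcases mul_eq_zero.1 this with h' | h'
    · have hp0 := (mul_eq_zero.1 h').resolve_left hlam
      exact hc0 (by rw [hc, hp0]; ring)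
    · exact hx0 h'

/-- The function `p (w - x) ^ 2 / (q (w - y) ^ 2)`, once the multiplicities of the zeros `u`, `v` of
`λ w R' - b` are known. Here `b t ^ 2 = p / q`, with the sign of `t` chosen so that
`t (u - x) = u - y`. Evaluating the identity `hC` at `x`, `0` and `y` determines `t`, then `t x / y`,
and then `λ`. -/
theorem exceptionalOne_of_double_root (hb : b ≠ 0) {x y u v : ℂ} (hx : x ≠ 0)
    (hy : y ≠ 0) (hxy : x ≠ y) (hp : f.p2 ≠ 0) (hq : f.q2 ≠ 0)
    (hP : ∀ w, f.P w = f.p2 * (w - x) ^ 2) (hQ : ∀ w, f.Q w = f.q2 * (w - y) ^ 2)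
    (huv : u ≠ v) (hPu : f.P u = b * f.Q u) (hPv : f.P v = b * f.Q v) (hQu : f.Q u ≠ 0)
    (hC : ∀ w, 2 * lam * f.p2 * (x - y) * w * (w - x) - b * f.q2 * (w - y) ^ 3 =
      -b * f.q2 * ((w - u) ^ 2 * (w - v))) :
    f.ExceptionalOne lam b ∨ f.rev.ExceptionalOne (-lam) b := by
  have hux : u - x ≠ 0 := by
    intro h
    rw [hP, h] at hPu
    simp [hb, hQu] at hPu
  have hbq := mul_ne_zero hb hq
  have hyx : y - x ≠ 0 := sub_ne_zero.2 hxy.symm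
  obtain ⟨t, ht⟩ : ∃ t, u - y = t * (u - x) := ⟨_, (div_mul_cancel₀ _ hux).symm⟩
  have hp2 : f.p2 = b * f.q2 * t ^ 2 := by
    apply mul_right_cancel₀ (pow_ne_zero 2 hux)
    rw [← hP, hPu, hQ, ht]; ring
  have ht0 : t ≠ 0 := by rintro rfl; simp [hp2] at hp
  have ht1 : t - 1 ≠ 0 := by
    intro h
    have : t = 1 := by linear_combination h
    rw [this] at ht
    exact hyx (by linear_combination -ht)
  have hv : v - y = -t * (v - x) := by
    have e : b * f.q2 * ((v - y - t * (v - x)) * (v - y + t * (v - x))) = 0 := by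
      rw [hP, hQ, hp2] at hPv
      linear_combination -hPv
    rcases mul_eq_zero.1 ((mul_eq_zero.1 e).resolve_left hbq) with e | e
    · exact absurd (mul_left_cancel₀ ht1 (by linear_combination e - ht)) huv
    · linear_combination e
  have eux : (t - 1) * (x - u) = y - x := by linear_combination ht
  have evx : (t + 1) * (x - v) = -(y - x) := by linear_combination -hv
  have euy : (t - 1) * (y - u) = t * (y - x) := by linear_combination ht
  have evy : (t + 1) * (y - v) = t * (y - x) := by linear_combination -hv
  -- the identity at the double zero `x`
  have key : (t - 1) ^ 2 * (t + 1) = 1 := by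
    have h1 := hC x
    have h2 : -(y - x) ^ 3 = (x - u) ^ 2 * (x - v) := by
      apply mul_left_cancel₀ hbq
      linear_combination -h1
    apply mul_right_cancel₀ (pow_ne_zero 3 hyx)
    linear_combination -(t - 1) ^ 2 * (t + 1) * h2 - ((t - 1) * (x - u) + (y - x)) *
      (t + 1) * (x - v) * eux - (y - x) ^ 2 * evx
  have hgold : t ^ 2 - t - 1 = 0 := by
    apply mul_left_cancel₀ ht0
    linear_combination key
  -- the identity at `0`; the two solutions for `t x` are `t y` and `(1 - t) y`, and `x ≠ y`
  have htx : t * x = (1 - t) * y := by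
    have h1 := hC 0
    have h2 : y ^ 3 = u ^ 2 * v := by
      apply mul_left_cancel₀ hbq
      linear_combination h1
    have eu : (t - 1) * u = t * x - y := by linear_combination -ht
    have ev : (t + 1) * v = t * x + y := by linear_combination hv
    have h3 : y ^ 3 = (t * x - y) ^ 2 * (t * x + y) := by
      linear_combination (t - 1) ^ 2 * (t + 1) * h2 - y ^ 3 * key +
        ((t - 1) * u + (t * x - y)) * (t + 1) * v * eu + (t * x - y) ^ 2 * ev
    have h4 : t * x * (t * (x - y) * (t * x - (1 - t) * y)) = 0 := by
      linear_combination -h3 - t * x * y ^ 2 * hgold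
    have h5 := (mul_eq_zero.1 h4).resolve_left (mul_ne_zero ht0 hx)
    exact sub_eq_zero.1 ((mul_eq_zero.1 h5).resolve_left
      (mul_ne_zero ht0 (sub_ne_zero.2 hxy)))
  -- the identity at the double pole `y`
  have hlam2 : 2 * lam = 2 * t - 1 := by
    have h1 := hC y
    have h2 : 2 * lam * t ^ 2 * (y - x) ^ 2 * y = (y - u) ^ 2 * (y - v) := by
      rw [hp2] at h1
      apply mul_left_cancel₀ hbq
      linear_combination -h1
    have h3 : 2 * lam * t ^ 2 * (y - x) ^ 2 * y = t ^ 3 * (y - x) ^ 3 := by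
      linear_combination (t - 1) ^ 2 * (t + 1) * h2 - 2 * lam * t ^ 2 * (y - x) ^ 2 * y * key +
        ((t - 1) * (y - u) + t * (y - x)) * (t + 1) * (y - v) * euy + t ^ 2 * (y - x) ^ 2 * evy
    apply mul_left_cancel₀ (mul_ne_zero (mul_ne_zero (pow_ne_zero 2 ht0) (pow_ne_zero 2 hyx)) hy)
    linear_combination h3 - t ^ 2 * (y - x) ^ 2 * htx
  have h5 := ofReal_sqrt_five_sq
  have hsq : (2 * t - 1 - (Real.sqrt 5 : ℂ)) * (2 * t - 1 + (Real.sqrt 5 : ℂ)) = 0 := by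
    linear_combination 4 * hgold - h5
  rcases mul_eq_zero.1 hsq with e | e
  · left
    refine ⟨by linear_combination hlam2 / 2 + e / 2, -1 / y, by simp [hy], fun w => ?_⟩
    have hs : (Real.sqrt 5 : ℂ) = 2 * t - 1 := by linear_combination -e
    rw [hP, hQ, hp2, hs]
    field_simp
    rw [show t ^ 2 * (w - x) ^ 2 = (t * w - (1 - t) * y) ^ 2 by rw [← htx]; ring]
    ring
  · right
    refine ⟨by linear_combination -hlam2 / 2 - e / 2, -y, by simp [hy], fun w => ?_⟩
    have hs : (Real.sqrt 5 : ℂ) = 1 - 2 * t := by linear_combination e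
    have h0 := hP 0
    have h1 := hP 1
    have g0 := hQ 0
    have g1 := hQ 1
    have hPr : f.rev.P w = f.p2 * (1 - x * w) ^ 2 := by
      simp only [P, QuadPair.rev] at *
      linear_combination w ^ 2 * h0 + w * (h1 - h0)
    have hQr : f.rev.Q w = f.q2 * (1 - y * w) ^ 2 := by
      simp only [Q, QuadPair.rev] at *
      linear_combination w ^ 2 * g0 + w * (g1 - g0)
    rw [hPr, hQr, hp2, hs]
    have : t ^ 2 * (1 - x * w) ^ 2 = (t - (1 - t) * y * w) ^ 2 := by rw [← htx]; ring
    linear_combination b * f.q2 * (1 - y * w) ^ 2 * this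

/-- The case of a double zero `x` and a double pole `y` in `ℂ \ {0}`. After division by `w - y`, the
numerator of `λ w R' - b` is a cubic polynomial with zeros in the set of the two `b`-points of `R`,
so one of them is double. -/
theorem exceptionalOne_of_double (h : f.Coprime) (hlam : lam ≠ 0) (hb : b ≠ 0)
    (hs : f.Shares lam b) {x y : ℂ} (hx : x ≠ 0) (hy : y ≠ 0) (hxy : x ≠ y)
    (hPx : f.P x = 0) (hPx' : f.p1 + 2 * f.p2 * x = 0)
    (hQy : f.Q y = 0) (hQy' : f.q1 + 2 * f.q2 * y = 0) :
    f.ExceptionalOne lam b ∨ f.rev.ExceptionalOne (-lam) b := by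
  have hP : ∀ w, f.P w = f.p2 * (w - x) ^ 2 := by
    intro w; simp only [P] at *; linear_combination hPx + (w - x) * hPx'
  have hQ : ∀ w, f.Q w = f.q2 * (w - y) ^ 2 := by
    intro w; simp only [Q] at *; linear_combination hQy + (w - y) * hQy'
  have hp : f.p2 ≠ 0 := by
    intro hp
    exact h.finite y (by rw [hP, hp, zero_mul]) hQy
  have hq : f.q2 ≠ 0 := by
    intro hq
    exact h.finite x hPx (by rw [hQ, hq, zero_mul])
  obtain ⟨u, v, huv, hu, hv, hQu, hQv, hPu, hPv, hFu, hFv, -, hG⟩ := hs.exists_points h hlam hb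
  have hne := sub_ne_zero.2 (hs.value_infinity_ne h hlam hb)
  have hp1 : f.p1 = -2 * f.p2 * x := by linear_combination hPx'
  have hq1 : f.q1 = -2 * f.q2 * y := by linear_combination hQy'
  have hW : ∀ w, f.W w = 2 * f.p2 * f.q2 * (x - y) * (w - x) * (w - y) := by
    intro w; rw [W_eq 0, hP, hQ, hp1, hq1]; ring
  have hF : ∀ w, lam * w * f.W w - b * f.Q w ^ 2 = f.q2 * (w - y) *
      (b * f.q2 * y ^ 3 + (-2 * lam * f.p2 * (x - y) * x - 3 * b * f.q2 * y ^ 2) * w +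
        (2 * lam * f.p2 * (x - y) + 3 * b * f.q2 * y) * w ^ 2 + -b * f.q2 * w ^ 3 +
        0 * w ^ 4) := by
    intro w; rw [hW, hQ]; ring
  have aux : ∀ w, f.Q w ≠ 0 → lam * w * f.W w = b * f.Q w ^ 2 →
      b * f.q2 * y ^ 3 + (-2 * lam * f.p2 * (x - y) * x - 3 * b * f.q2 * y ^ 2) * w +
        (2 * lam * f.p2 * (x - y) + 3 * b * f.q2 * y) * w ^ 2 + -b * f.q2 * w ^ 3 +
        0 * w ^ 4 = 0 := by
    intro w hw hFw
    have := hF w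
    rw [hFw, sub_self, eq_comm, mul_eq_zero] at this
    refine this.resolve_left (mul_ne_zero hq fun hwx => hw ?_)
    rw [hQ, hwx]; ring
  -- the third zero of the cubic polynomial
  obtain ⟨s, hs'⟩ : ∃ s, 2 * lam * f.p2 * (x - y) + 3 * b * f.q2 * y = b * f.q2 * (u + v + s) :=
    ⟨(2 * lam * f.p2 * (x - y) + 3 * b * f.q2 * y) / (b * f.q2) - (u + v), by field_simp; ring⟩
  have hC : ∀ w, 2 * lam * f.p2 * (x - y) * w * (w - x) - b * f.q2 * (w - y) ^ 3 =
      -b * f.q2 * ((w - u) * (w - v) * (w - s)) := by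
    intro w
    linear_combination quartic_eq_of_two_roots huv (aux u hQu hFu) (aux v hQv hFv) w +
      (w - u) * (w - v) * hs'
  have hs0 : s ≠ 0 := by
    rintro rfl
    have := hC 0
    have h' : b * f.q2 * y ^ 3 = 0 := by linear_combination this
    simp [hb, hq, hy] at h'
  have hsy : s - y ≠ 0 := by
    intro hsy
    have hsy : s = y := sub_eq_zero.1 hsy
    have := hC y
    rw [hsy] at this
    have h' : lam * f.p2 * y * (x - y) ^ 2 = 0 := by linear_combination -this / 2
    simp [hlam, hp, hy, sub_ne_zero.2 hxy] at h'
  have hQs : f.Q s ≠ 0 := by rw [hQ]; exact mul_ne_zero hq (pow_ne_zero 2 hsy)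
  have hPs : f.P s = b * f.Q s := by
    refine (hs s hs0 hQs).2 (sub_eq_zero.1 ?_)
    rw [hF]
    linear_combination f.q2 * (s - y) * hC s
  have hsuv : s = u ∨ s = v := by
    have := hG s
    rw [hPs, sub_self, eq_comm, mul_eq_zero, mul_eq_zero] at this
    exact (this.resolve_left hne).imp sub_eq_zero.1 sub_eq_zero.1
  rcases hsuv with rfl | rfl
  · exact exceptionalOne_of_double_root hb hx hy hxy hp hq hP hQ huv hPu hPv hQu
      fun w => by rw [hC]; ring
  · exact exceptionalOne_of_double_root hb hx hy hxy hp hq hP hQ huv.symm hPv hPu hQv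
      fun w => by rw [hC]; ring

/-- The functions for which `0` and a nonzero value `b` are shared, sorted by whether `0` and `∞` are
critical points: `p1 q0 - p0 q1` and `p2 q1 - p1 q2` are the extreme coefficients of `W`. -/
theorem classification (h : f.Coprime) (hlam : lam ≠ 0) (hb : b ≠ 0)
    (hs0 : f.Shares lam 0) (hs : f.Shares lam b) :
    f.Fixed lam ∨ (f.ExceptionalOne lam b ∨ f.rev.ExceptionalOne (-lam) b) ∨
      (f.ExceptionalTwo lam b ∨ f.rev.ExceptionalTwo (-lam) b) := by
  by_cases h0 : f.p1 * f.q0 - f.p0 * f.q1 = 0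
  · by_cases h2 : f.p2 * f.q1 - f.p1 * f.q2 = 0
    · -- `0` and `∞` are the critical points
      have h1 : f.p2 * f.q0 - f.p0 * f.q2 ≠ 0 := by
        intro h1
        have hW : ∀ w, f.W w = 0 := by
          intro w; simp only [W]; linear_combination h0 + 2 * w * h1 + w ^ 2 * h2
        obtain ⟨u, v, -, hu, -, hQu, -, -, -, hFu, -⟩ := hs.exists_points h hlam hb
        rw [hW, mul_zero, eq_comm] at hFu
        simp [hb, hQu] at hFu
      have hp1 : f.p1 = 0 := by
        apply mul_left_cancel₀ h1
        linear_combination f.p2 * h0 + f.p0 * h2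
      have hq1 : f.q1 = 0 := by
        apply mul_left_cancel₀ h1
        linear_combination f.q2 * h0 + f.q0 * h2
      rcases even h hlam hb hp1 hq1 hs0 hs with h | h
      · exact .inl h
      · exact .inr (.inr h)
    · exact (not_critical_infinity h.rev (neg_ne_zero.2 hlam) hb hs0.rev hs.rev
        (by simp only [rev]; linear_combination -h0)
        (by simp only [rev]; intro h'; exact h2 (by linear_combination -h'))).elim
  by_cases h2 : f.p2 * f.q1 - f.p1 * f.q2 = 0
  · exact (not_critical_infinity h hlam hb hs0 hs h2 h0).elim
  obtain ⟨x, y, e1, e0⟩ := exists_factor_quadratic h2 (f.p1 * f.q0 - f.p0 * f.q1)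
    (2 * (f.p2 * f.q0 - f.p0 * f.q2))
  have hxy : x * y ≠ 0 := by intro h'; rw [h', mul_zero] at e0; exact h0 e0
  have hx := left_ne_zero_of_mul hxy
  have hy := right_ne_zero_of_mul hxy
  have hWx : f.W x = 0 := by simp only [W]; linear_combination e0 + x * e1
  have hWy : f.W y = 0 := by simp only [W]; linear_combination e0 + y * e1
  refine .inr (.inl ?_)
  rcases double_of_critical h hs0 hx hWx with ⟨hx1, hx2⟩ | ⟨hx1, hx2⟩ <;>
    rcases double_of_critical h hs0 hy hWy with ⟨hy1, hy2⟩ | ⟨hy1, hy2⟩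
  · exfalso
    have hp2 : f.p2 ≠ 0 := by
      intro hp
      have : f.p1 = 0 := by simpa [hp] using hx2
      exact h2 (by rw [hp, this]; ring)
    -- a double critical point would be a common zero of `P` and `Q`
    obtain rfl : x = y := mul_left_cancel₀ hp2 (by linear_combination (hx2 - hy2) / 2)
    refine h.finite x hx1 (mul_left_cancel₀ hp2 ?_)
    have hp1 : f.p1 = -2 * f.p2 * x := by linear_combination hx2
    have hp0 : f.p0 = f.p2 * x ^ 2 := by simp only [P] at hx1; linear_combination hx1 - x * hp1
    rw [hp1, hp0] at e1
    simp only [Q]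
    linear_combination e1 / 2
  · refine exceptionalOne_of_double h hlam hb hs hx hy ?_ hx1 hx2 hy1 hy2
    rintro rfl
    exact h.finite x hx1 hy1
  · refine exceptionalOne_of_double h hlam hb hs hy hx ?_ hy1 hy2 hx1 hx2
    rintro rfl
    exact h.finite _ hy1 hx1
  · exfalso
    have hq2 : f.q2 ≠ 0 := by
      intro hq
      have : f.q1 = 0 := by simpa [hq] using hx2
      exact h2 (by rw [hq, this]; ring)
    obtain rfl : x = y := mul_left_cancel₀ hq2 (by linear_combination (hx2 - hy2) / 2)
    refine h.finite x (mul_left_cancel₀ hq2 ?_) hx1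
    have hq1 : f.q1 = -2 * f.q2 * x := by linear_combination hx2
    have hq0 : f.q0 = f.q2 * x ^ 2 := by simp only [Q] at hx1; linear_combination hx1 - x * hq1
    rw [hq1, hq0] at e1
    simp only [P]
    linear_combination -e1 / 2

/-- An even function is not exceptional of the first kind: its pole would also be a zero. -/
theorem not_exceptionalOne_of_even {f : QuadPair} {lam b : ℂ} (h : f.Coprime) (hb : b ≠ 0)
    (hp1 : f.p1 = 0) (hq1 : f.q1 = 0) : ¬ f.ExceptionalOne lam b := by
  rintro ⟨-, c, hc, H⟩
  have hP : ∀ w, f.P (-w) = f.P w := by intro w; simp [P, hp1]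
  have hQ : ∀ w, f.Q (-w) = f.Q w := by intro w; simp [Q, hq1]
  have h5 := ofReal_sqrt_five_sq
  have hcc : c * c⁻¹ = 1 := mul_inv_cancel₀ hc
  have h1 := H (-c⁻¹)
  have h2 := H c⁻¹
  rw [hP, hQ] at h1
  have hQ0 : f.Q c⁻¹ = 0 := by
    have h3 : b * 5 * f.Q c⁻¹ = 0 := by
      rw [mul_neg, mul_neg, mul_assoc _ c, hcc] at h1
      linear_combination -h1 - b * f.Q c⁻¹ * h5
    simpa [hb] using h3
  have hP0 : f.P c⁻¹ = 0 := by
    rw [hcc, hQ0] at h2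
    linear_combination h2 / 4
  exact h.finite _ hP0 hQ0

end QuadPair

/-! ### Evaluation of rational functions -/

open QuadPair

theorem algebraMap_eq_of_eval_eq {p q : Polynomial ℂ} (h : ∀ w, w ≠ 0 → p.eval w = q.eval w) :
    algebraMap (Polynomial ℂ) (RatFunc ℂ) p = algebraMap (Polynomial ℂ) (RatFunc ℂ) q := by
  congr 1
  refine Polynomial.eq_of_infinite_eval_eq p q (Set.Infinite.mono (s := {0}ᶜ) (fun w hw => ?_) ?_)
  · exact h w hw
  · exact (Set.finite_singleton 0).infinite_compl

theorem num_mul_eq_of_eq_div {S : RatFunc ℂ} {A B : Polynomial ℂ} (hB : B ≠ 0)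
    (hS : S = algebraMap (Polynomial ℂ) (RatFunc ℂ) A / algebraMap (Polynomial ℂ) (RatFunc ℂ) B) :
    S.num * B = A * S.denom :=
  (RatFunc.num_mul_eq_mul_denom_iff hB).2 hS

/-- The value of a quotient may be read off from a representation that is not in lowest terms, as
long as its denominator does not vanish. -/
theorem value_div {A B : Polynomial ℂ} {w : ℂ} (hB : B.eval w ≠ 0) :
    value (algebraMap (Polynomial ℂ) (RatFunc ℂ) A / algebraMap (Polynomial ℂ) (RatFunc ℂ) B) w =
      ((A.eval w / B.eval w : ℂ) : OnePoint ℂ) := by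
  have hB0 : B ≠ 0 := by rintro rfl; simp at hB
  generalize hS : algebraMap (Polynomial ℂ) (RatFunc ℂ) A /
    algebraMap (Polynomial ℂ) (RatFunc ℂ) B = S
  have h := congrArg (Polynomial.eval w) (num_mul_eq_of_eq_div hB0 hS.symm)
  simp only [Polynomial.eval_mul] at h
  have hd : S.denom.eval w ≠ 0 := by
    intro hd
    obtain ⟨u, v, huv⟩ := S.isCoprime_num_denom
    rw [hd, mul_zero] at h
    have := congrArg (Polynomial.eval w) huv
    simp [hd, (mul_eq_zero.1 h).resolve_right hB] at this
  rw [value, if_neg hd, (div_eq_div_iff hd hB).2 h]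

/-- The numerator `P' Q - P Q'` of the derivative of `P / Q`. -/
noncomputable def derivNum (R : RatFunc ℂ) : Polynomial ℂ :=
  Polynomial.derivative R.num * R.denom - R.num * Polynomial.derivative R.denom

theorem dz_eq_div (lam : ℂ) (R : RatFunc ℂ) : dz lam R =
    algebraMap (Polynomial ℂ) (RatFunc ℂ) (Polynomial.C lam * Polynomial.X * derivNum R) /
      algebraMap (Polynomial ℂ) (RatFunc ℂ) (R.denom ^ 2) := by
  simp only [dz, derivative, derivNum, map_mul, RatFunc.algebraMap_C, RatFunc.algebraMap_X]
  rw [mul_div_assoc]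

theorem Share.eval_iff {R : RatFunc ℂ} {lam a : ℂ}
    (h : Share R (dz lam R) (a : OnePoint ℂ) {w : ℂ | w ≠ 0}) {w : ℂ} (hw : w ≠ 0)
    (hd : R.denom.eval w ≠ 0) : R.num.eval w = a * R.denom.eval w ↔
      lam * w * (derivNum R).eval w = a * R.denom.eval w ^ 2 := by
  have := h w hw
  rw [dz_eq_div, value_div (by simpa using hd), value, if_neg hd, OnePoint.coe_eq_coe,
    OnePoint.coe_eq_coe, div_eq_iff hd, div_eq_iff (by simpa using hd)] at this
  simpa using this

theorem eq_dz_of_eval {R : RatFunc ℂ} {lam : ℂ}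
    (h : ∀ w, R.num.eval w * R.denom.eval w = lam * w * (derivNum R).eval w) :
    R = dz lam R := by
  have hd : algebraMap (Polynomial ℂ) (RatFunc ℂ) R.denom ≠ 0 :=
    RatFunc.algebraMap_ne_zero R.denom_ne_zero
  rw [dz_eq_div]
  conv_lhs => rw [← R.num_div_denom]
  rw [map_pow, div_eq_div_iff hd (pow_ne_zero 2 hd), ← map_pow, ← map_mul, ← map_mul]
  refine algebraMap_eq_of_eval_eq fun w _ => ?_
  have := h w
  simp only [Polynomial.eval_mul, Polynomial.eval_pow, Polynomial.eval_C, Polynomial.eval_X]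
  linear_combination R.denom.eval w * this

theorem eval_of_natDegree_le_two {p : Polynomial ℂ} (hp : p.natDegree ≤ 2) (w : ℂ) :
    p.eval w = p.coeff 0 + p.coeff 1 * w + p.coeff 2 * w ^ 2 := by
  rw [Polynomial.eval_eq_sum_range' (Nat.lt_succ_of_le hp)]
  simp [Finset.sum_range_succ]

theorem eval_derivative_of_natDegree_le_two {p : Polynomial ℂ} (hp : p.natDegree ≤ 2) (w : ℂ) :
    (Polynomial.derivative p).eval w = p.coeff 1 + 2 * p.coeff 2 * w := by
  have hd : (Polynomial.derivative p).natDegree < 2 :=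
    lt_of_le_of_lt (Polynomial.natDegree_derivative_le p) (by omega)
  rw [Polynomial.eval_eq_sum_range' hd]
  simp only [Finset.sum_range_succ, Finset.sum_range_zero, Polynomial.coeff_derivative]
  push_cast
  ring

theorem degree_pos {R : RatFunc ℂ} (hR : ∀ k : ℂ, R ≠ RatFunc.C k) : 0 < degree R := by
  by_contra! h
  have h1 : R.num.natDegree = 0 := by unfold degree at h; omega
  have h2 : R.denom.natDegree = 0 := by unfold degree at h; omega
  refine hR (R.num.coeff 0 / R.denom.coeff 0) ?_
  conv_lhs => rw [← R.num_div_denom, Polynomial.eq_C_of_natDegree_eq_zero h1,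
    Polynomial.eq_C_of_natDegree_eq_zero h2]
  rw [RatFunc.algebraMap_C, RatFunc.algebraMap_C, map_div₀]

/-- `f` is the pair of numerator and denominator of `w ↦ R (w ^ k)`; the last condition is the chain
rule for this function. -/
def QuadPair.Represents (f : QuadPair) (R : RatFunc ℂ) (k : ℕ) : Prop :=
  ∀ w, f.P w = R.num.eval (w ^ k) ∧ f.Q w = R.denom.eval (w ^ k) ∧
    w * f.W w = k * w ^ k * (derivNum R).eval (w ^ k)

/-- The function `R` itself, in degree two, or `w ↦ R (w ^ 2)`, in degree one, is given by a
`QuadPair`. -/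
theorem exists_quadPair (R : RatFunc ℂ) (hR : ∀ k : ℂ, R ≠ RatFunc.C k) (hdeg : degree R ≤ 2) :
    ∃ (f : QuadPair) (k : ℕ), degree R * k = 2 ∧ f.Coprime ∧
      (k = 2 → f.p1 = 0 ∧ f.q1 = 0) ∧ f.Represents R k := by
  have hcop : ∀ w, R.num.eval w = 0 → R.denom.eval w ≠ 0 := by
    intro w h1 h2
    obtain ⟨u, v, huv⟩ := R.isCoprime_num_denom
    have := congrArg (Polynomial.eval w) huv
    simp [h1, h2] at this
  have hn : R.num.natDegree ≤ 2 := (le_max_left _ _).trans hdeg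
  have hd : R.denom.natDegree ≤ 2 := (le_max_right _ _).trans hdeg
  have en := eval_of_natDegree_le_two hn
  have ed := eval_of_natDegree_le_two hd
  have eW : ∀ w, (derivNum R).eval w = _ := fun w => by
    rw [derivNum, Polynomial.eval_sub, Polynomial.eval_mul, Polynomial.eval_mul,
      eval_derivative_of_natDegree_le_two hn, eval_derivative_of_natDegree_le_two hd, en, ed]
  have hpos := degree_pos hR
  have hlt : ∀ m, 0 < m → R.num.coeff m = 0 → R.denom.coeff m = 0 → degree R ≤ m →
      degree R < m := by
    intro m hm h1 h2 hdm
    have aux : ∀ p : Polynomial ℂ, p.coeff m = 0 → p.natDegree ≤ m → p.natDegree < m := by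
      intro p hp hpm
      refine lt_of_le_of_ne hpm fun he => ?_
      have h0 : p = 0 := by
        rw [← Polynomial.leadingCoeff_eq_zero, Polynomial.leadingCoeff, he, hp]
      rw [h0, Polynomial.natDegree_zero] at he
      omega
    exact max_lt (aux _ h1 ((le_max_left _ _).trans hdm)) (aux _ h2 ((le_max_right _ _).trans hdm))
  obtain hd2 | hd1 : degree R = 2 ∨ degree R = 1 := by omega
  · refine ⟨⟨R.num.coeff 0, R.num.coeff 1, R.num.coeff 2, R.denom.coeff 0, R.denom.coeff 1,
      R.denom.coeff 2⟩, 1, by omega, ⟨fun w h1 h2 => ?_, fun h1 h2 => ?_⟩, by omega,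
      fun w => ⟨?_, ?_, ?_⟩⟩
    · exact hcop w ((en w).trans h1) ((ed w).trans h2)
    · have := hlt 2 two_pos h1 h2 hdeg
      omega
    · rw [en]; simp [P]
    · rw [ed]; simp [Q]
    · rw [eW]; simp only [W]; push_cast; ring
  · have hn2 : R.num.coeff 2 = 0 :=
      Polynomial.coeff_eq_zero_of_natDegree_lt
        (lt_of_le_of_lt (le_max_left _ _) (hd1.trans_lt one_lt_two))
    have hd2 : R.denom.coeff 2 = 0 :=
      Polynomial.coeff_eq_zero_of_natDegree_lt
        (lt_of_le_of_lt (le_max_right _ _) (hd1.trans_lt one_lt_two))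
    simp only [hn2, hd2] at en ed eW
    refine ⟨⟨R.num.coeff 0, 0, R.num.coeff 1, R.denom.coeff 0, 0, R.denom.coeff 1⟩, 2, by omega,
      ⟨fun w h1 h2 => ?_, fun h1 h2 => ?_⟩, fun _ => ⟨rfl, rfl⟩, fun w => ⟨?_, ?_, ?_⟩⟩
    · refine hcop (w ^ 2) (Eq.trans ?_ h1) (Eq.trans ?_ h2)
      · rw [en]; simp only [P]; ring
      · rw [ed]; simp only [Q]; ring
    · have := hlt 1 one_pos h1 h2 hd1.le
      omega
    · rw [en]; simp only [P]; ring
    · rw [ed]; simp only [Q]; ring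
    · rw [eW]; simp only [W]; push_cast; ring

/-- The substitution may be carried out in any representation of a rational function whose
denominator does not become `0`. -/
theorem substPow_div (A B : Polynomial ℂ) (n : ℤ)
    (hB : B.eval₂ RatFunc.C ((RatFunc.X : RatFunc ℂ) ^ n) ≠ 0) :
    substPow (algebraMap (Polynomial ℂ) (RatFunc ℂ) A / algebraMap (Polynomial ℂ) (RatFunc ℂ) B) n =
      A.eval₂ RatFunc.C ((RatFunc.X : RatFunc ℂ) ^ n) /
        B.eval₂ RatFunc.C ((RatFunc.X : RatFunc ℂ) ^ n) := by
  have hB0 : B ≠ 0 := by rintro rfl; simp at hB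
  generalize hS : algebraMap (Polynomial ℂ) (RatFunc ℂ) A /
    algebraMap (Polynomial ℂ) (RatFunc ℂ) B = S
  have h := congrArg (Polynomial.eval₂ RatFunc.C ((RatFunc.X : RatFunc ℂ) ^ n))
    (num_mul_eq_of_eq_div hB0 hS.symm)
  simp only [Polynomial.eval₂_mul] at h
  have hd : S.denom.eval₂ RatFunc.C ((RatFunc.X : RatFunc ℂ) ^ n) ≠ 0 := by
    intro hd
    obtain ⟨u, v, huv⟩ := S.isCoprime_num_denom
    rw [hd, mul_zero] at h
    have := congrArg (Polynomial.eval₂ RatFunc.C ((RatFunc.X : RatFunc ℂ) ^ n)) huv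
    simp [Polynomial.eval₂_add, Polynomial.eval₂_mul, hd, (mul_eq_zero.1 h).resolve_right hB]
      at this
  rw [substPow, RatFunc.eval, (div_eq_div_iff hd hB).2 h]

theorem one_add_mul_X_pow_ne_zero (c : ℂ) {m : ℕ} (hm : m ≠ 0) :
    1 + RatFunc.C c * (RatFunc.X : RatFunc ℂ) ^ m ≠ 0 := by
  have h : (1 + Polynomial.C c * Polynomial.X ^ m : Polynomial ℂ) ≠ 0 := by
    intro h
    have := congrArg (Polynomial.eval 0) h
    simp [hm] at this
  simpa using RatFunc.algebraMap_ne_zero h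

theorem X_pow_add_ne_zero (c : ℂ) {m : ℕ} (hm : m ≠ 0) :
    (RatFunc.X : RatFunc ℂ) ^ m + RatFunc.C c ≠ 0 := by
  have h : (Polynomial.X ^ m + Polynomial.C c : Polynomial ℂ) ≠ 0 :=
    Polynomial.X_pow_add_C_ne_zero (Nat.pos_of_ne_zero hm) c
  simpa using RatFunc.algebraMap_ne_zero h

theorem one_add_mul_X_zpow_ne_zero (c : ℂ) {n : ℤ} (hn : n ≠ 0) :
    1 + RatFunc.C c * (RatFunc.X : RatFunc ℂ) ^ n ≠ 0 := by
  obtain ⟨m, rfl | rfl⟩ := n.eq_nat_or_neg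
  · rw [zpow_natCast]
    exact one_add_mul_X_pow_ne_zero c (by simpa using hn)
  · intro h
    have hX : (RatFunc.X : RatFunc ℂ) ^ m ≠ 0 := pow_ne_zero m RatFunc.X_ne_zero
    refine X_pow_add_ne_zero c (m := m) (by simpa using hn) ?_
    rw [zpow_neg, zpow_natCast] at h
    field_simp at h
    rw [h, mul_zero]

theorem one_sub_mul_X_zpow_ne_zero (c : ℂ) {n : ℤ} (hn : n ≠ 0) :
    1 - RatFunc.C c * (RatFunc.X : RatFunc ℂ) ^ n ≠ 0 := by
  have := one_add_mul_X_zpow_ne_zero (-c) hn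
  rwa [map_neg, neg_mul, ← sub_eq_add_neg] at this

theorem substPow_gundersenOne (c : ℂ) {n : ℤ} (hn : n ≠ 0) : substPow (gundersenOne c) n =
    (RatFunc.C ((1 - (Real.sqrt 5 : ℂ)) / 2) +
      RatFunc.C ((1 + (Real.sqrt 5 : ℂ)) / 2) * RatFunc.C c * RatFunc.X ^ n) ^ 2 /
    (1 + RatFunc.C c * RatFunc.X ^ n) ^ 2 := by
  have h := substPow_div
    ((Polynomial.C ((1 - (Real.sqrt 5 : ℂ)) / 2) +
      Polynomial.C ((1 + (Real.sqrt 5 : ℂ)) / 2) * Polynomial.C c * Polynomial.X) ^ 2)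
    ((1 + Polynomial.C c * Polynomial.X) ^ 2) n
    (by
      simp only [Polynomial.eval₂_pow, Polynomial.eval₂_add, Polynomial.eval₂_mul,
        Polynomial.eval₂_C, Polynomial.eval₂_X, Polynomial.eval₂_one]
      exact pow_ne_zero 2 (one_add_mul_X_zpow_ne_zero c hn))
  simp only [Polynomial.eval₂_pow, Polynomial.eval₂_add, Polynomial.eval₂_mul,
    Polynomial.eval₂_C, Polynomial.eval₂_X, Polynomial.eval₂_one, map_pow, map_add, map_mul,
    map_one, RatFunc.algebraMap_C, RatFunc.algebraMap_X] at h
  rw [← h, gundersenOne, div_pow]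

theorem substPow_gundersenTwo (c : ℂ) {n : ℤ} (hn : n ≠ 0) : substPow (gundersenTwo c) n =
    2 / (1 - RatFunc.C c * RatFunc.X ^ n) := by
  have h := substPow_div 2 (1 - Polynomial.C c * Polynomial.X) n
    (by simpa [Polynomial.eval₂_sub, Polynomial.eval₂_mul] using one_sub_mul_X_zpow_ne_zero c hn)
  simp only [Polynomial.eval₂_sub, Polynomial.eval₂_mul, Polynomial.eval₂_ofNat,
    Polynomial.eval₂_C, Polynomial.eval₂_X, Polynomial.eval₂_one, map_sub, map_mul,
    map_one, map_ofNat, RatFunc.algebraMap_C, RatFunc.algebraMap_X] at h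
  rw [← h, gundersenTwo]

theorem eq_C_mul_div {R N D : RatFunc ℂ} {b : ℂ} (hD : D ≠ 0)
    (h : algebraMap (Polynomial ℂ) (RatFunc ℂ) R.num * D =
      RatFunc.C b * N * algebraMap (Polynomial ℂ) (RatFunc ℂ) R.denom) :
    R = RatFunc.C b * (N / D) := by
  conv_lhs => rw [← R.num_div_denom]
  rw [← mul_div_assoc, div_eq_div_iff (RatFunc.algebraMap_ne_zero R.denom_ne_zero) hD, h]

theorem isTransform_gundersenOne {R : RatFunc ℂ} {lam b c : ℂ} (hb : b ≠ 0)
    (hlam : lam = (Real.sqrt 5 : ℂ) / 2) (h : ∀ w, R.num.eval w * (1 + c * w) ^ 2 =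
      b * ((1 - (Real.sqrt 5 : ℂ)) / 2 + (1 + (Real.sqrt 5 : ℂ)) / 2 * c * w) ^ 2 *
        R.denom.eval w) :
    IsTransform R lam (gundersenOne c) ((Real.sqrt 5 : ℂ) / 2) b 1 := by
  refine ⟨hb, one_ne_zero, by simpa using hlam, ?_⟩
  rw [substPow_gundersenOne c one_ne_zero]
  refine eq_C_mul_div (pow_ne_zero 2 (one_add_mul_X_zpow_ne_zero c one_ne_zero)) ?_
  have key := algebraMap_eq_of_eval_eq
    (p := R.num * (1 + Polynomial.C c * Polynomial.X) ^ 2)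
    (q := Polynomial.C b * (Polynomial.C ((1 - (Real.sqrt 5 : ℂ)) / 2) +
      Polynomial.C ((1 + (Real.sqrt 5 : ℂ)) / 2) * Polynomial.C c * Polynomial.X) ^ 2 * R.denom)
    (fun w _ => by simpa using h w)
  simp only [map_pow, map_add, map_mul, map_one, RatFunc.algebraMap_C, RatFunc.algebraMap_X]
    at key
  rw [zpow_one, key]

theorem isTransform_gundersenOne_neg {R : RatFunc ℂ} {lam b c : ℂ} (hb : b ≠ 0)
    (hlam : -lam = (Real.sqrt 5 : ℂ) / 2) (h : ∀ w, w ≠ 0 → R.num.eval w * (w + c) ^ 2 =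
      b * ((1 - (Real.sqrt 5 : ℂ)) / 2 * w + (1 + (Real.sqrt 5 : ℂ)) / 2 * c) ^ 2 *
        R.denom.eval w) :
    IsTransform R lam (gundersenOne c) ((Real.sqrt 5 : ℂ) / 2) b (-1) := by
  have hn : (-1 : ℤ) ≠ 0 := by norm_num
  refine ⟨hb, hn, by simpa using hlam, ?_⟩
  rw [substPow_gundersenOne c hn]
  refine eq_C_mul_div (pow_ne_zero 2 (one_add_mul_X_zpow_ne_zero c hn)) ?_
  have key := algebraMap_eq_of_eval_eq
    (p := R.num * (Polynomial.X + Polynomial.C c) ^ 2)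
    (q := Polynomial.C b * (Polynomial.C ((1 - (Real.sqrt 5 : ℂ)) / 2) * Polynomial.X +
      Polynomial.C ((1 + (Real.sqrt 5 : ℂ)) / 2) * Polynomial.C c) ^ 2 * R.denom)
    (fun w hw => by simpa using h w hw)
  simp only [map_pow, map_add, map_mul, RatFunc.algebraMap_C, RatFunc.algebraMap_X] at key
  have hX : (RatFunc.X : RatFunc ℂ) * RatFunc.X⁻¹ = 1 := mul_inv_cancel₀ RatFunc.X_ne_zero
  rw [zpow_neg_one]
  apply mul_left_cancel₀ (pow_ne_zero 2 (RatFunc.X_ne_zero (K := ℂ)))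
  rw [← sub_eq_zero] at key ⊢
  rw [← key]
  generalize (RatFunc.X : RatFunc ℂ)⁻¹ = Y at hX
  generalize RatFunc.C ((1 - (Real.sqrt 5 : ℂ)) / 2) = A
  generalize RatFunc.C ((1 + (Real.sqrt 5 : ℂ)) / 2) = B
  have e1 : RatFunc.X * (1 + RatFunc.C c * Y) = RatFunc.X + RatFunc.C c := by
    linear_combination RatFunc.C c * hX
  have e2 : RatFunc.X * (A + B * RatFunc.C c * Y) = A * RatFunc.X + B * RatFunc.C c := by
    linear_combination B * RatFunc.C c * hX
  rw [← e1, ← e2]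
  ring

theorem isTransform_gundersenTwo {R : RatFunc ℂ} {lam b c : ℂ} {d : ℕ} (hb : b ≠ 0)
    (hd : d ≠ 0) (hlam : lam * d = -2)
    (h : ∀ w, R.num.eval w * (1 - c * w ^ d) = b * 2 * R.denom.eval w) :
    IsTransform R lam (gundersenTwo c) (-2) b d := by
  have hn : (d : ℤ) ≠ 0 := by simpa using hd
  refine ⟨hb, hn, by simpa using hlam, ?_⟩
  rw [substPow_gundersenTwo c hn]
  refine eq_C_mul_div (one_sub_mul_X_zpow_ne_zero c hn) ?_
  have key := algebraMap_eq_of_eval_eq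
    (p := R.num * (1 - Polynomial.C c * Polynomial.X ^ d))
    (q := Polynomial.C b * 2 * R.denom) (fun w _ => by simpa using h w)
  simp only [map_pow, map_sub, map_mul, map_one, map_ofNat, RatFunc.algebraMap_C,
    RatFunc.algebraMap_X] at key
  rw [zpow_natCast, key]

theorem isTransform_gundersenTwo_neg {R : RatFunc ℂ} {lam b c : ℂ} {d : ℕ} (hb : b ≠ 0)
    (hd : d ≠ 0) (hlam : lam * d = 2)
    (h : ∀ w, w ≠ 0 → R.num.eval w * (w ^ d - c) = b * 2 * w ^ d * R.denom.eval w) :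
    IsTransform R lam (gundersenTwo c) (-2) b (-d) := by
  have hn : -(d : ℤ) ≠ 0 := by simpa using hd
  refine ⟨hb, hn, by push_cast; linear_combination -hlam, ?_⟩
  rw [substPow_gundersenTwo c hn]
  refine eq_C_mul_div (one_sub_mul_X_zpow_ne_zero c hn) ?_
  have key := algebraMap_eq_of_eval_eq
    (p := R.num * (Polynomial.X ^ d - Polynomial.C c))
    (q := Polynomial.C b * 2 * Polynomial.X ^ d * R.denom) (fun w hw => by simpa using h w hw)
  simp only [map_pow, map_sub, map_mul, map_ofNat, RatFunc.algebraMap_C,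
    RatFunc.algebraMap_X] at key
  have hXd : (RatFunc.X : RatFunc ℂ) ^ d ≠ 0 := pow_ne_zero d RatFunc.X_ne_zero
  have hX : (RatFunc.X : RatFunc ℂ) ^ d * (RatFunc.X ^ d)⁻¹ = 1 := mul_inv_cancel₀ hXd
  rw [zpow_neg, zpow_natCast]
  apply mul_left_cancel₀ hXd
  linear_combination key - algebraMap (Polynomial ℂ) (RatFunc ℂ) R.num * RatFunc.C c * hX

variable {R : RatFunc ℂ} {f : QuadPair} {k : ℕ} {lam a b : ℂ}

theorem Share.quadPair (hk : k ≠ 0) (hf : f.Represents R k)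
    (h : Share R (dz lam R) (a : OnePoint ℂ) {w : ℂ | w ≠ 0}) : f.Shares (lam / k) a := by
  intro w hw hQ
  obtain ⟨e1, e2, e3⟩ := hf w
  have hk' : (k : ℂ) ≠ 0 := Nat.cast_ne_zero.2 hk
  rw [e2] at hQ
  have e4 : lam / k * w * f.W w = lam * w ^ k * (derivNum R).eval (w ^ k) := by
    rw [mul_assoc, e3]; field_simp
  rw [e1, e2, e4, h.eval_iff (pow_ne_zero k hw) hQ]

theorem eq_dz_of_fixed (hk : k ≠ 0) (hf : f.Represents R k)
    (h : f.Fixed (lam / k)) : R = dz lam R := by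
  refine eq_dz_of_eval fun u => ?_
  obtain ⟨w, rfl⟩ := IsAlgClosed.exists_pow_nat_eq u (Nat.pos_of_ne_zero hk)
  obtain ⟨e1, e2, e3⟩ := hf w
  have hk' : (k : ℂ) ≠ 0 := Nat.cast_ne_zero.2 hk
  rw [← e1, ← e2, h w, mul_assoc, e3]
  field_simp

/-- The functions of degree at most two for which `0` and a nonzero value `b` are shared. -/
theorem classification_zero {R : RatFunc ℂ} {lam b : ℂ} (hR : ∀ k : ℂ, R ≠ RatFunc.C k)
    (hdeg : degree R ≤ 2) (hlam : lam ≠ 0) (hb : b ≠ 0)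
    (h0 : Share R (dz lam R) ((0 : ℂ) : OnePoint ℂ) {w : ℂ | w ≠ 0})
    (hs : Share R (dz lam R) (b : OnePoint ℂ) {w : ℂ | w ≠ 0}) :
    R = dz lam R ∨ ∃ c : ℂ, ∃ n : ℤ, c ≠ 0 ∧
      (((n = 1 ∨ n = -1) ∧
          IsTransform R lam (gundersenOne c) ((Real.sqrt 5 : ℂ) / 2) b n) ∨
        ((n = (degree R : ℤ) ∨ n = -(degree R : ℤ)) ∧
          IsTransform R lam (gundersenTwo c) (-2) b n)) := by
  obtain ⟨f, k, hdk, hcop, heven, hf⟩ := exists_quadPair R hR hdeg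
  have hk : k ≠ 0 := by rintro rfl; simp at hdk
  have hd : degree R ≠ 0 := (degree_pos hR).ne'
  have hk' : (k : ℂ) ≠ 0 := Nat.cast_ne_zero.2 hk
  have hdk' : (degree R : ℂ) * k = 2 := by exact_mod_cast hdk
  have hk12 : k = 1 ∨ k = 2 := by
    have : k ∣ 2 := ⟨degree R, by rw [← hdk, mul_comm]⟩
    exact (Nat.dvd_prime Nat.prime_two).1 this
  have hPow : ∀ w : ℂ, w ^ 2 = (w ^ k) ^ degree R := by
    intro w; rw [← pow_mul, mul_comm, hdk]
  rcases QuadPair.classification hcop (div_ne_zero hlam hk') hb (h0.quadPair hk hf)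
    (hs.quadPair hk hf) with H | (H | H) | (H | H)
  · exact .inl (eq_dz_of_fixed hk hf H)
  · rcases hk12 with rfl | rfl
    · obtain ⟨hl, c, hc, H⟩ := H
      refine .inr ⟨c, 1, hc, .inl ⟨.inl rfl, isTransform_gundersenOne hb (by simpa using hl)
        fun w => ?_⟩⟩
      have := H w
      rwa [(hf w).1, (hf w).2.1, pow_one] at this
    · exact (not_exceptionalOne_of_even hcop hb (heven rfl).1 (heven rfl).2 H).elim
  · rcases hk12 with rfl | rfl
    · obtain ⟨hl, c, hc, H⟩ := H
      refine .inr ⟨c, -1, hc, .inl ⟨.inr rfl, isTransform_gundersenOne_neg hb (by simpa using hl)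
        fun w hw => ?_⟩⟩
      have := H w⁻¹
      rw [P_rev (inv_ne_zero hw), Q_rev (inv_ne_zero hw), inv_inv, (hf w).1, (hf w).2.1,
        pow_one] at this
      have e : w * w⁻¹ = 1 := mul_inv_cancel₀ hw
      have e1 : w + c = w * (1 + c * w⁻¹) := by linear_combination -c * e
      have e2 : (1 - (Real.sqrt 5 : ℂ)) / 2 * w + (1 + (Real.sqrt 5 : ℂ)) / 2 * c =
          w * ((1 - (Real.sqrt 5 : ℂ)) / 2 + (1 + (Real.sqrt 5 : ℂ)) / 2 * c * w⁻¹) := by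
        linear_combination -(1 + (Real.sqrt 5 : ℂ)) / 2 * c * e
      apply mul_left_cancel₀ (pow_ne_zero 2 (inv_ne_zero hw))
      rw [e1, e2]
      linear_combination w ^ 2 * this
    · exact (not_exceptionalOne_of_even hcop.rev hb (heven rfl).1 (heven rfl).2 H).elim
  · obtain ⟨hl, c, hc, H⟩ := H
    refine .inr ⟨c, degree R, hc, .inr ⟨.inl rfl, isTransform_gundersenTwo hb hd ?_
      fun u => ?_⟩⟩
    · rw [div_eq_iff hk'] at hl
      rw [hl]; linear_combination -hdk'
    · obtain ⟨w, rfl⟩ := IsAlgClosed.exists_pow_nat_eq u (Nat.pos_of_ne_zero hk)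
      rw [← hPow, ← (hf w).1, ← (hf w).2.1, H]
  · obtain ⟨hl, c, hc, H⟩ := H
    refine .inr ⟨c, -degree R, hc, .inr ⟨.inr rfl, isTransform_gundersenTwo_neg hb hd ?_
      fun u hu => ?_⟩⟩
    · rw [neg_inj, div_eq_iff hk', one_mul] at hl
      rw [hl, mul_comm]; exact hdk'
    · obtain ⟨w, rfl⟩ := IsAlgClosed.exists_pow_nat_eq u (Nat.pos_of_ne_zero hk)
      have hw : w ≠ 0 := by rintro rfl; simp [hk] at hu
      have := H w⁻¹
      rw [P_rev (inv_ne_zero hw), Q_rev (inv_ne_zero hw), inv_inv] at this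
      rw [← hPow, ← (hf w).1, ← (hf w).2.1]
      field_simp at this
      linear_combination this

theorem eq_dz_of_share_ne_zero {R : RatFunc ℂ} {lam a b : ℂ} (hR : ∀ k : ℂ, R ≠ RatFunc.C k)
    (hdeg : degree R ≤ 2) (hlam : lam ≠ 0) (hab : a ≠ b) (ha0 : a ≠ 0) (hb0 : b ≠ 0)
    (ha : Share R (dz lam R) (a : OnePoint ℂ) {w : ℂ | w ≠ 0})
    (hb : Share R (dz lam R) (b : OnePoint ℂ) {w : ℂ | w ≠ 0}) : R = dz lam R := by
  obtain ⟨f, k, hdk, hcop, -, hf⟩ := exists_quadPair R hR hdeg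
  have hk : k ≠ 0 := by rintro rfl; simp at hdk
  exact eq_dz_of_fixed hk hf (fixed_of_shares hcop (div_ne_zero hlam (Nat.cast_ne_zero.2 hk))
    ha0 hb0 hab (ha.quadPair hk hf) (hb.quadPair hk hf))

end SharedValues

theorem mainTheorem4 (R : RatFunc ℂ) (lam a b : ℂ)
    (hR : ∀ k : ℂ, R ≠ RatFunc.C k)
    (hdeg : SharedValues.degree R ≤ 2)
    (hlam : lam ≠ 0)
    (hab : a ≠ b)
    (ha : SharedValues.Share R (SharedValues.dz lam R) (a : OnePoint ℂ) {w : ℂ | w ≠ 0})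
    (hb : SharedValues.Share R (SharedValues.dz lam R) (b : OnePoint ℂ) {w : ℂ | w ≠ 0}) :
    (R = SharedValues.dz lam R ∨
      ∃ β c : ℂ, ∃ n : ℤ, c ≠ 0 ∧ ({a, b} : Set ℂ) = {0, β} ∧
        (((n = 1 ∨ n = -1) ∧
            SharedValues.IsTransform R lam (SharedValues.gundersenOne c)
              ((Real.sqrt 5 : ℂ) / 2) β n) ∨
          ((n = (SharedValues.degree R : ℤ) ∨ n = -(SharedValues.degree R : ℤ)) ∧
            SharedValues.IsTransform R lam (SharedValues.gundersenTwo c) (-2) β n))) ∧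
    (a ≠ 0 → b ≠ 0 → R = SharedValues.dz lam R) := by
  have key := fun ha0 hb0 =>
    SharedValues.eq_dz_of_share_ne_zero hR hdeg hlam hab ha0 hb0 ha hb
  refine ⟨?_, key⟩
  rcases eq_or_ne a 0 with rfl | ha0
  · refine (SharedValues.classification_zero hR hdeg hlam hab.symm ha hb).imp_right ?_
    rintro ⟨c, n, hc, H⟩
    exact ⟨b, c, n, hc, rfl, H⟩
  rcases eq_or_ne b 0 with rfl | hb0
  · refine (SharedValues.classification_zero hR hdeg hlam hab hb ha).imp_right ?_
    rintro ⟨c, n, hc, H⟩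
    exact ⟨a, c, n, hc, Set.pair_comm a 0, H⟩
  exact .inl (key ha0 hb0)
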